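/- Let $n\ge 1$ and let $M^n$ be a complete connected smooth Riemannian manifold, possibly with smooth boundary $\partial M$. Consider the Riemannian product $M\times\mathbb{R}$ with vertical unit field $\xi=(0,1)$ and slices $M_s=M\times\{s\}$, and the product weight $e^{\psi}$, $\psi(p,t)=h(p)+v(t)$, with $h\in C^\infty(M)$ and $v\in C^\infty(\mathbb{R})$. Suppose that there are $\lambda\ge 0$ and $a\in\mathbb{R}$ with $v'(t)\ge\lambda$ for all $t\le a$. Let $\Sigma$ be a connected two-sided smooth (immersed) hypersurface of $M\times\mathbb{R}$, possibly with smooth boundary $\partial\Sigma$, with the induced metric and a smooth unit normal $N$. Its $\psi$-mean curvature with respect to $N$ is $H_\psi=-\operatorname{div}_\Sigma N-\langle\nabla\psi,N\rangle$. Assume that $\Sigma\subseteq M\times(-\infty,a]$ and that $\Sigma$ is $\psi$-parabolic: every $u\in C^2(\Sigma)$ that is bounded from above, satisfies $\Delta_\Sigma u+\langle\nabla_\Sigma\psi,\nabla_\Sigma u\rangle\ge 0$ on $\Sigma\setminus\partial\Sigma$ and $\partial u/\partial\nu\ge 0$ along $\partial\Sigma$ ($\nu$ the inner unit conormal) is constant.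 Assume finally that either $|H_\psi|\le\lambda$ on $\Sigma$, or $\Sigma$ is a horizontal multigraph, i.e. $\langle\xi,N\rangle\le 0$ on $\Sigma$, with $H_\psi\le\lambda$ on $\Sigma$. (i) If $\partial\Sigma\ne\emptyset$ and $\Sigma$ is tangent to $M_a$ along $\partial\Sigma$ (that is, $\partial\Sigma\subseteq M_a$ and $T_x\Sigma=T_xM_a$ for all $x\in\partial\Sigma$), then $\Sigma\subseteq M_a$ and the $\psi$-mean curvature of $M_a$ with respect to $-\xi$ is identically $\lambda$. (ii) If $\Sigma$ is complete and has free boundary in $\partial M\times\mathbb{R}$ (that is, $\partial\Sigma=\Sigma\cap(\partial M\times\mathbb{R})$, possibly empty, and $\Sigma$ is orthogonal to $\partial M\times\mathbb{R}$ along $\partial\Sigma$), then $\Sigma=M_s$ for some $s\in\mathbb{R}$ such that the $\psi$-mean curvature of $M_s$ with respect to $-\xi$ is identically $\lambda$. -/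

import Mathlib

open Set Bundle Manifold
open scoped ContDiff

noncomputable section

namespace WeightedCylinder

section Coordinates

variable {E : Type*} [NormedAddCommGroup E] [NormedSpace ℝ E]
  {H : Type*} [TopologicalSpace H] {I : ModelWithCorners ℝ E H}
  {P : Type*} [TopologicalSpace P] [ChartedSpace H P]

/-- The coefficient `g(v, w)` of a metric tensor `g`, read at the point `y` of the model space in
the preferred chart around `x`; the vectors `v`, `w` are constant in this chart. -/
def coordMetric (g : ∀ x : P, TangentSpace I x → TangentSpace I x → ℝ) (x : P) (v w y : E) : ℝ :=
  g ((extChartAt I x).symm y)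
    (mfderivWithin 𝓘(ℝ, E) I (extChartAt I x).symm (range I) y v)
    (mfderivWithin 𝓘(ℝ, E) I (extChartAt I x).symm (range I) y w)

/-- The derivative at `x`, in the direction `u`, of the coefficient `g(v, w)` of the metric in the
preferred chart around `x`. -/
def dMetric (g : ∀ x : P, TangentSpace I x → TangentSpace I x → ℝ) (x : P) (u v w : E) : ℝ :=
  fderivWithin ℝ (coordMetric g x v w) (range I) (extChartAt I x x) u

/-- The Christoffel symbol of the first kind `g(D_u v, w)` at `x`, where `D` is the Levi-Civita
connection of `g` and `u`, `v`, `w` are extended as constant fields in the preferred chart around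
`x`. -/
def christoffel (g : ∀ x : P, TangentSpace I x → TangentSpace I x → ℝ) (x : P) (u v w : E) : ℝ :=
  (dMetric g x u v w + dMetric g x v u w - dMetric g x w u v) / 2

end Coordinates

section Riemannian

variable {E : Type*} [NormedAddCommGroup E] [NormedSpace ℝ E] [FiniteDimensional ℝ E]
  {H : Type*} [TopologicalSpace H] (I : ModelWithCorners ℝ E H)
  {S : Type*} [TopologicalSpace S] [ChartedSpace H S]
  [RiemannianBundle (fun x : S => TangentSpace I x)]

/-- The metric tensor of a Riemannian manifold. -/
def metricTensor (x : S) (v w : TangentSpace I x) : ℝ := inner ℝ v w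

instance finiteDimensional_tangentSpace (x : S) : FiniteDimensional ℝ (TangentSpace I x) :=
  inferInstanceAs (FiniteDimensional ℝ E)

/-- The trace of a bilinear form on `T_x S`, with respect to the Riemannian metric. -/
def metricTrace (x : S) (B : TangentSpace I x → TangentSpace I x → ℝ) : ℝ :=
  ∑ i, B (stdOrthonormalBasis ℝ (TangentSpace I x) i) (stdOrthonormalBasis ℝ (TangentSpace I x) i)

/-- The differential of a function at `x`, as a function on `T_x S`. -/
def differential {S : Type*} [TopologicalSpace S] [ChartedSpace H S] (u : S → ℝ) (x : S)
    (v : TangentSpace I x) : ℝ :=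
  mfderiv I 𝓘(ℝ, ℝ) u x v

/-- The Riemannian gradient, written in an orthonormal basis. -/
def grad (u : S → ℝ) (x : S) : TangentSpace I x :=
  ∑ i, differential I u x (stdOrthonormalBasis ℝ (TangentSpace I x) i) •
    stdOrthonormalBasis ℝ (TangentSpace I x) i

/-- The Hessian of `u` with respect to the Levi-Civita connection, computed in the preferred chart
at `x`: the second derivative of `u` at `(v, w)`, minus `du (D_v w) = g(D_v w, ∇u)`. -/
def hessian (u : S → ℝ) (x : S) (v w : TangentSpace I x) : ℝ :=
  (fderivWithin ℝ (fderivWithin ℝ (u ∘ (extChartAt I x).symm) (range I)) (range I)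
      (extChartAt I x x) : E →L[ℝ] E →L[ℝ] ℝ) v w
    - christoffel (metricTensor I) x v w (grad I u x)

/-- The drifted Laplacian `Δ u + ⟨∇ψ, ∇u⟩` of a Riemannian manifold with weight `e^ψ`. -/
def driftedLaplacian (ψ u : S → ℝ) (x : S) : ℝ :=
  metricTrace I x (hessian I u x) + inner ℝ (grad I ψ x) (grad I u x)

end Riemannian

section Boundary

variable {n : ℕ} [NeZero n]
  {S : Type*} [TopologicalSpace S] [ChartedSpace (EuclideanHalfSpace n) S]

/-- The component of a tangent vector transverse to the boundary of the half-space, in the preferred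
chart at `x`. If `x` is a boundary point, then it vanishes exactly on the vectors tangent to the
boundary, and is positive exactly on the vectors that point strictly inwards. -/
def transverse (x : S) (w : TangentSpace (𝓡∂ n) x) : ℝ :=
  (show EuclideanSpace ℝ (Fin n) from w) 0

variable [RiemannianBundle (fun x : S => TangentSpace (𝓡∂ n) x)]

/-- `ν` is the inner unit normal to the boundary at `x` (to be used at boundary points). -/
def IsInnerUnitNormal (x : S) (ν : TangentSpace (𝓡∂ n) x) : Prop :=
  inner ℝ ν ν = 1 ∧ (∀ w : TangentSpace (𝓡∂ n) x, transverse x w = 0 → inner ℝ ν w = 0) ∧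
    0 < transverse x ν

/-- Weighted parabolicity of a Riemannian manifold with boundary, with weight `e^ψ`: a `C²` function
that is bounded from above, `ψ`-subharmonic in the interior and satisfies the Neumann condition
`∂u/∂ν ≥ 0` along the boundary, is constant. -/
def IsParabolic (ψ : S → ℝ) : Prop :=
  ∀ u : S → ℝ, ContMDiff (𝓡∂ n) 𝓘(ℝ, ℝ) 2 u → BddAbove (range u) →
    (∀ x ∈ (𝓡∂ n).interior S, 0 ≤ driftedLaplacian (𝓡∂ n) ψ u x) →
    (∀ x ∈ (𝓡∂ n).boundary S, ∀ ν : TangentSpace (𝓡∂ n) x, IsInnerUnitNormal x ν →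
      0 ≤ differential (𝓡∂ n) u x ν) →
    ∃ c : ℝ, ∀ x, u x = c

end Boundary

section Cylinder

variable {n : ℕ} [NeZero n]

/-- The model with corners of the cylinder `M × ℝ`. -/
abbrev cylModel (n : ℕ) [NeZero n] :
    ModelWithCorners ℝ (EuclideanSpace ℝ (Fin n) × ℝ) (ModelProd (EuclideanHalfSpace n) ℝ) :=
  (𝓡∂ n).prod 𝓘(ℝ, ℝ)

variable {M : Type*} [TopologicalSpace M] [ChartedSpace (EuclideanHalfSpace n) M]

/-- The component in `T_p M` of a vector tangent to `M × ℝ` at `y = (p, t)`. -/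
def horiz (y : M × ℝ) (w : TangentSpace (cylModel n) y) : TangentSpace (𝓡∂ n) y.1 :=
  (show EuclideanSpace ℝ (Fin n) × ℝ from w).1

/-- The component in `ℝ` of a vector tangent to `M × ℝ` at `y = (p, t)`. -/
def vert (y : M × ℝ) (w : TangentSpace (cylModel n) y) : ℝ :=
  (show EuclideanSpace ℝ (Fin n) × ℝ from w).2

/-- The vertical vector field `ξ = (0, 1)`. -/
def xi (y : M × ℝ) : TangentSpace (cylModel n) y :=
  (show TangentSpace (cylModel n) y from ((0, 1) : EuclideanSpace ℝ (Fin n) × ℝ))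

/-- The inclusion of the horizontal slice `M × {s}`. -/
def slice (s : ℝ) (p : M) : M × ℝ := (p, s)

/-- The downward unit normal `-ξ` along the horizontal slice `M × {s}`. -/
def sliceNormal (s : ℝ) (p : M) : TangentSpace (cylModel n) (slice s p) := -xi (slice s p)

/-- The product weight exponent `ψ(p, t) = h(p) + v(t)`. -/
def productWeight (h : M → ℝ) (v : ℝ → ℝ) (y : M × ℝ) : ℝ := h y.1 + v y.2

variable [RiemannianBundle (fun x : M => TangentSpace (𝓡∂ n) x)]

/-- The product metric of `M × ℝ`. -/
def cylMetric (y : M × ℝ) (v w : TangentSpace (cylModel n) y) : ℝ :=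
  inner ℝ (horiz y v) (horiz y w) + vert y v * vert y w

variable {S : Type*} [TopologicalSpace S] [ChartedSpace (EuclideanHalfSpace n) S]
  [RiemannianBundle (fun x : S => TangentSpace (𝓡∂ n) x)]

/-- `F : S → M × ℝ` is an immersed hypersurface, the metric of `S` is the induced one, and `N` is a
Gauss map, i.e. a smooth unit normal field along `F`. (A two-sided embedded hypersurface is the case
where `F` is an inclusion.) -/
structure IsTwoSidedHypersurface [IsManifold (𝓡∂ n) ∞ M] (F : S → M × ℝ)
    (N : ∀ x : S, TangentSpace (cylModel n) (F x)) : Prop where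
  smooth : ContMDiff (𝓡∂ n) (cylModel n) ∞ F
  isometric : ∀ (x : S) (v w : TangentSpace (𝓡∂ n) x),
    cylMetric (F x) (mfderiv (𝓡∂ n) (cylModel n) F x v) (mfderiv (𝓡∂ n) (cylModel n) F x w)
      = inner ℝ v w
  smooth_normal : ContMDiff (𝓡∂ n) (cylModel n).tangent ∞
    (fun x => (⟨F x, N x⟩ : TangentBundle (cylModel n) (M × ℝ)))
  unit : ∀ x, cylMetric (F x) (N x) (N x) = 1
  normal : ∀ (x : S) (v : TangentSpace (𝓡∂ n) x),
    cylMetric (F x) (N x) (mfderiv (𝓡∂ n) (cylModel n) F x v) = 0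

/-- The components of a vector field `X` along `F` in the preferred chart of `M × ℝ` around `F x`,
as a function of the point `z`. -/
def coordField {S : Type*} (F : S → M × ℝ) (X : ∀ x : S, TangentSpace (cylModel n) (F x))
    (x z : S) : EuclideanSpace ℝ (Fin n) × ℝ :=
  mfderiv (cylModel n) 𝓘(ℝ, EuclideanSpace ℝ (Fin n) × ℝ) (extChartAt (cylModel n) (F x)) (F z)
    (X z)

/-- `⟨D_v X, w⟩` at `x`, for a vector field `X` along `F`, where `D` is the Levi-Civita connection
of `M × ℝ`. -/
def covDerivInner (F : S → M × ℝ) (X : ∀ x : S, TangentSpace (cylModel n) (F x)) (x : S)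
    (v : TangentSpace (𝓡∂ n) x) (w : TangentSpace (cylModel n) (F x)) : ℝ :=
  cylMetric (F x)
      (mfderiv (𝓡∂ n) 𝓘(ℝ, EuclideanSpace ℝ (Fin n) × ℝ) (coordField F X x) x v) w
    + christoffel cylMetric (F x) (mfderiv (𝓡∂ n) (cylModel n) F x v) (X x) w

/-- The weighted divergence `div_Σ X + ⟨∇ψ, X⟩` of a vector field `X` along the hypersurface. -/
def weightedDiv (ψ : M × ℝ → ℝ) (F : S → M × ℝ) (X : ∀ x : S, TangentSpace (cylModel n) (F x))
    (x : S) : ℝ :=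
  metricTrace (𝓡∂ n) x
      (fun v w => covDerivInner F X x v (mfderiv (𝓡∂ n) (cylModel n) F x w))
    + differential (cylModel n) ψ (F x) (X x)

/-- The weighted mean curvature `H_ψ` with respect to the Gauss map `N`. -/
def weightedMeanCurvature (ψ : M × ℝ → ℝ) (F : S → M × ℝ)
    (N : ∀ x : S, TangentSpace (cylModel n) (F x)) (x : S) : ℝ :=
  -weightedDiv ψ F N x

/-- The angle function `θ = ⟨ξ, N⟩`. -/
def angle (F : S → M × ℝ) (N : ∀ x : S, TangentSpace (cylModel n) (F x)) (x : S) : ℝ :=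
  cylMetric (F x) (xi (F x)) (N x)

/-- The hypersurface is tangent to the slice `M × {a}` along its boundary: boundary points lie in
the slice, and there the tangent space is the horizontal one. -/
def IsTangentToSlice {S : Type*} [TopologicalSpace S] [ChartedSpace (EuclideanHalfSpace n) S]
    {M : Type*} [TopologicalSpace M] [ChartedSpace (EuclideanHalfSpace n) M]
    (F : S → M × ℝ) (a : ℝ) : Prop :=
  ∀ x ∈ (𝓡∂ n).boundary S, (F x).2 = a ∧
    ∀ w : TangentSpace (cylModel n) (F x),
      (∃ v : TangentSpace (𝓡∂ n) x, mfderiv (𝓡∂ n) (cylModel n) F x v = w) ↔ vert (F x) w = 0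

/-- Free boundary in `∂M × ℝ`: the boundary of the hypersurface is its intersection with `∂M × ℝ`,
and there it is orthogonal to `∂M × ℝ`, i.e. the Gauss map is tangent to `∂M × ℝ`. -/
def HasFreeBoundary {S : Type*} [TopologicalSpace S] [ChartedSpace (EuclideanHalfSpace n) S]
    {M : Type*} [TopologicalSpace M] [ChartedSpace (EuclideanHalfSpace n) M]
    (F : S → M × ℝ) (N : ∀ x : S, TangentSpace (cylModel n) (F x)) : Prop :=
  (∀ x, x ∈ (𝓡∂ n).boundary S ↔ (F x).1 ∈ (𝓡∂ n).boundary M) ∧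
    ∀ x ∈ (𝓡∂ n).boundary S, transverse (F x).1 (horiz (F x) (N x)) = 0

end Cylinder

end WeightedCylinder

end

namespace WeightedCylinder
open Filter Topology Metric

/-- A map between closed convex sets with nonempty interior which sends boundary points to boundary
points, interior points to interior points, and has an invertible differential at a point, has a
`C¹` local inverse there, also when this point is on the boundary. -/
theorem exists_contDiffOn_localInverse {E F : Type*}
    [NormedAddCommGroup E] [NormedSpace ℝ E] [FiniteDimensional ℝ E]
    [NormedAddCommGroup F] [NormedSpace ℝ F] [FiniteDimensional ℝ F]
    {R U : Set E} {R' : Set F} (hRc : IsClosed R) (hR : Convex ℝ R) (hRi : (interior R).Nonempty)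
    (hRc' : IsClosed R') (hR' : Convex ℝ R') (hRi' : (interior R').Nonempty)
    {f : E → F} {x₀ : E} (hU : IsOpen U) (hx₀ : x₀ ∈ R ∩ U) (hf : ContDiffOn ℝ 1 f (R ∩ U))
    (A : E ≃L[ℝ] F) (hA : fderivWithin ℝ f R x₀ = A) (hmaps : MapsTo f (R ∩ U) R')
    (hfr : ∀ z ∈ R ∩ U, f z ∈ frontier R' ↔ z ∈ frontier R) :
    ∃ (g : F → E) (V : Set F), IsOpen V ∧ f x₀ ∈ V ∧ g (f x₀) = x₀ ∧
      MapsTo g (R' ∩ V) (R ∩ U) ∧ (∀ y ∈ R' ∩ V, f (g y) = y) ∧ ContDiffOn ℝ 1 g (R' ∩ V) := by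
  have : CompleteSpace E := FiniteDimensional.complete ℝ E
  have hud : UniqueDiffOn ℝ R := uniqueDiffOn_convex hR hRi
  set D := fderivWithin ℝ f R with hD
  have hDeq : ∀ z ∈ R ∩ U, fderivWithin ℝ f (R ∩ U) z = D z := fun z hz =>
    fderivWithin_inter (hU.mem_nhds hz.2)
  have hDc : ContinuousOn D (R ∩ U) :=
    (hf.continuousOn_fderivWithin (hud.inter hU) le_rfl).congr fun z hz => (hDeq z hz).symm
  have hDf : ∀ z ∈ R ∩ U, HasFDerivWithinAt f (D z) (R ∩ U) z := fun z hz => by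
    rw [← hDeq z hz]
    exact (hf.differentiableOn one_ne_zero z hz).hasFDerivWithinAt
  obtain ⟨c, hc0, hc⟩ : ∃ c : NNReal, 0 < c ∧
      (Subsingleton E ∨ lipschitzExtensionConstant F * c < ‖(A.symm : F →L[ℝ] E)‖₊⁻¹) := by
    rcases subsingleton_or_nontrivial E with h | h
    · exact ⟨1, one_pos, Or.inl h⟩
    have hn : 0 < ‖(A.symm : F →L[ℝ] E)‖₊⁻¹ := by
      rw [inv_pos]
      exact A.nnnorm_symm_pos
    have hk := lipschitzExtensionConstant_pos F
    refine ⟨‖(A.symm : F →L[ℝ] E)‖₊⁻¹ / (2 * lipschitzExtensionConstant F), by positivity,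
      Or.inr ?_⟩
    calc lipschitzExtensionConstant F *
          (‖(A.symm : F →L[ℝ] E)‖₊⁻¹ / (2 * lipschitzExtensionConstant F))
        = ‖(A.symm : F →L[ℝ] E)‖₊⁻¹ / 2 := by field_simp
      _ < ‖(A.symm : F →L[ℝ] E)‖₊⁻¹ := half_lt_self hn
  obtain ⟨r, hr0, hrU, hr⟩ : ∃ r > 0, ball x₀ r ⊆ U ∧ ∀ z ∈ R ∩ ball x₀ r,
      ‖D z - A‖ ≤ c ∧ ∃ B : E ≃L[ℝ] F, (B : E →L[ℝ] F) = D z := by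
    have h1 : Tendsto D (𝓝[R ∩ U] x₀) (𝓝 (A : E →L[ℝ] F)) := by
      rw [← hA]; exact hDc x₀ hx₀
    have h2 : ∀ᶠ z in 𝓝[R] x₀, ‖D z - A‖ ≤ c ∧ ∃ B : E ≃L[ℝ] F, (B : E →L[ℝ] F) = D z := by
      rw [← nhdsWithin_inter_of_mem' (mem_nhdsWithin_of_mem_nhds (hU.mem_nhds hx₀.2))]
      have h3 := h1 (A.nhds)
      have h4 := h1 (closedBall_mem_nhds (A : E →L[ℝ] F) (NNReal.coe_pos.2 hc0))
      filter_upwards [h3, h4] with z hz3 hz4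
      exact ⟨by simpa [dist_eq_norm] using hz4, hz3⟩
    obtain ⟨r1, hr1, h5⟩ := Metric.mem_nhdsWithin_iff.1 h2
    obtain ⟨r2, hr2, h6⟩ := Metric.isOpen_iff.1 hU x₀ hx₀.2
    refine ⟨min r1 r2, lt_min hr1 hr2, (ball_subset_ball (min_le_right _ _)).trans h6, ?_⟩
    exact fun z hz => h5 ⟨ball_subset_ball (min_le_left _ _) hz.2, hz.1⟩
  have hsub : R ∩ ball x₀ r ⊆ R ∩ U := inter_subset_inter_right _ hrU
  have happ : ApproximatesLinearOn f (A : E →L[ℝ] F) (R ∩ ball x₀ r) c := by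
    intro x hx y hy
    exact (hR.inter (convex_ball x₀ r)).norm_image_sub_le_of_norm_hasFDerivWithin_le'
      (fun z hz => (hDf z (hsub hz)).mono hsub) (fun z hz => (hr z hz).1) hy hx
  obtain ⟨G, hG⟩ := happ.exists_homeomorph_extension hc
  have hx₀B : x₀ ∈ R ∩ ball x₀ r := ⟨hx₀.1, mem_ball_self hr0⟩
  have hGx : G.symm (f x₀) = x₀ := by rw [hG hx₀B, G.symm_apply_apply]
  obtain ⟨ρ, hρ0, hρ⟩ : ∃ ρ > 0, ball (f x₀) ρ ⊆ G.symm ⁻¹' ball x₀ r := by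
    refine Metric.isOpen_iff.1 (isOpen_ball.preimage G.symm.continuous) _ ?_
    rw [mem_preimage, hGx]; exact mem_ball_self hr0
  -- interior points of the target ball come from interior points
  have hball : ∀ y ∈ interior R' ∩ ball (f x₀) ρ, G.symm y ∈ R := by
    have hconn : IsPreconnected (G.symm '' (interior R' ∩ ball (f x₀) ρ)) :=
      ((hR'.interior.inter (convex_ball _ _)).isPreconnected).image _ G.symm.continuous.continuousOn
    have hmeet : (G.symm '' (interior R' ∩ ball (f x₀) ρ) ∩ interior R).Nonempty := by
      have hcl : x₀ ∈ closure (interior R) := by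
        rw [hR.closure_interior_eq_closure_of_nonempty_interior hRi]
        exact subset_closure hx₀.1
      have hopen : IsOpen (ball x₀ r ∩ G ⁻¹' ball (f x₀) ρ) :=
        isOpen_ball.inter (isOpen_ball.preimage G.continuous)
      have hmem : x₀ ∈ ball x₀ r ∩ G ⁻¹' ball (f x₀) ρ := by
        refine ⟨mem_ball_self hr0, ?_⟩
        rw [mem_preimage, ← hG hx₀B]; exact mem_ball_self hρ0
      obtain ⟨z, ⟨hz1, hz2⟩, hz3⟩ := mem_closure_iff.1 hcl _ hopen hmem
      have hzB : z ∈ R ∩ ball x₀ r := ⟨interior_subset hz3, hz1⟩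
      refine ⟨z, ⟨G z, ⟨?_, hz2⟩, G.symm_apply_apply z⟩, hz3⟩
      rw [← hG hzB]
      by_contra hcon
      have : f z ∈ frontier R' := by
        rw [hRc'.frontier_eq]; exact ⟨hmaps (hsub hzB), hcon⟩
      exact ((hRc.frontier_eq ▸ (hfr z (hsub hzB)).1 this).2) hz3
    have hdisj : ∀ z ∈ G.symm '' (interior R' ∩ ball (f x₀) ρ), z ∉ frontier R := by
      rintro _ ⟨y, hy, rfl⟩ hfry
      have hzB : G.symm y ∈ R ∩ ball x₀ r := ⟨hRc.frontier_subset hfry, hρ hy.2⟩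
      have := (hfr _ (hsub hzB)).2 hfry
      rw [hG hzB, G.apply_symm_apply] at this
      exact (hRc'.frontier_eq ▸ this).2 hy.1
    have hsubset : G.symm '' (interior R' ∩ ball (f x₀) ρ) ⊆ interior R := by
      refine hconn.subset_left_of_subset_union isOpen_interior hRc.isOpen_compl
        (disjoint_compl_right.mono_left interior_subset) (fun z hz => ?_) hmeet
      by_cases hzR : z ∈ R
      · left
        by_contra hcon
        exact hdisj z hz (hRc.frontier_eq ▸ ⟨hzR, hcon⟩)
      · exact Or.inr hzR
    exact fun y hy => interior_subset (hsubset (mem_image_of_mem _ hy))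
  have hmem : ∀ y ∈ R' ∩ ball (f x₀) ρ, G.symm y ∈ R ∩ ball x₀ r := by
    refine fun y hy => ⟨?_, hρ hy.2⟩
    have hy' : y ∈ closure (interior R' ∩ ball (f x₀) ρ) := by
      rw [inter_comm]
      refine isOpen_ball.inter_closure ⟨hy.2, ?_⟩
      rw [hR'.closure_interior_eq_closure_of_nonempty_interior hRi']
      exact subset_closure hy.1
    exact hRc.closure_subset_iff.2 (image_subset_iff.2 hball)
      (image_closure_subset_closure_image G.symm.continuous (mem_image_of_mem _ hy'))
  have hinv : ∀ y ∈ R' ∩ ball (f x₀) ρ, f (G.symm y) = y := fun y hy => by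
    rw [hG (hmem y hy), G.apply_symm_apply]
  refine ⟨G.symm, ball (f x₀) ρ, isOpen_ball, mem_ball_self hρ0, hGx,
    fun y hy => hsub (hmem y hy), hinv, ?_⟩
  rw [show (1 : WithTop ℕ∞) = 0 + 1 by norm_num,
    contDiffOn_succ_iff_hasFDerivWithinAt_of_uniqueDiffOn
      ((uniqueDiffOn_convex hR' hRi').inter isOpen_ball)]
  refine ⟨by simp, fun y => (D (G.symm y)).inverse, ?_, ?_⟩
  · rw [contDiffOn_zero]
    intro y hy
    obtain ⟨B, hB⟩ := (hr _ (hmem y hy)).2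
    have h1 : ContinuousAt (ContinuousLinearMap.inverse : (E →L[ℝ] F) → F →L[ℝ] E)
        (D (G.symm y)) := by
      rw [← hB]
      exact (contDiffAt_map_inverse (n := 0) B).continuousAt
    refine h1.comp_continuousWithinAt (f := fun y => D (G.symm y)) ?_
    exact (hDc _ (hsub (hmem y hy))).comp G.symm.continuous.continuousWithinAt
      fun w hw => hsub (hmem w hw)
  · intro y hy
    obtain ⟨B, hB⟩ := (hr _ (hmem y hy)).2
    beta_reduce
    rw [← hB, ContinuousLinearMap.inverse_equiv]
    refine HasFDerivWithinAt.of_local_left_inverse (f := f) (t := R ∩ U) ?_ ?_ hy ?_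
    · exact tendsto_nhdsWithin_iff.2 ⟨G.symm.continuous.continuousWithinAt,
        eventually_nhdsWithin_of_forall fun w hw => hsub (hmem w hw)⟩
    · rw [hB]; exact hDf _ (hsub (hmem y hy))
    · exact eventually_nhdsWithin_of_forall hinv

/-- A Caristi-type existence result: on a complete metric space, a nonnegative continuous function
which can always be decreased at a rate proportional to the distance has a zero. -/
theorem exists_eq_zero_of_decreasing_step {X : Type*} [MetricSpace X] [CompleteSpace X] [Nonempty X]
    {φ : X → ℝ} (hφ : Continuous φ) (hpos : ∀ x, 0 ≤ φ x) {K : ℝ}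
    (hstep : ∀ x, φ x ≠ 0 → ∃ x', φ x' < φ x ∧ dist x x' ≤ K * (φ x - φ x')) :
    ∃ x, φ x = 0 := by
  by_contra! hne
  let T : X → Set X := fun x => {x' | dist x x' ≤ K * (φ x - φ x')}
  have hTtrans : ∀ {x y z}, y ∈ T x → z ∈ T y → z ∈ T x := fun {x y z} h1 h2 => by
    have h1' : dist x y ≤ K * (φ x - φ y) := h1
    have h2' : dist y z ≤ K * (φ y - φ z) := h2
    change dist x z ≤ K * (φ x - φ z)
    linarith [dist_triangle x y z]
  have hbdd : ∀ x, BddBelow (φ '' T x) := fun x => ⟨0, by rintro _ ⟨y, -, rfl⟩; exact hpos y⟩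
  have hnext : ∀ x, ∃ y ∈ T x, φ y ≤ (φ x + sInf (φ '' T x)) / 2 ∧ φ y < φ x := by
    intro x
    obtain ⟨x', hx', hd⟩ := hstep x (hne x)
    have hlt : sInf (φ '' T x) < φ x := (csInf_le (hbdd x) (mem_image_of_mem φ hd)).trans_lt hx'
    obtain ⟨_, ⟨y, hy, rfl⟩, hlt'⟩ := exists_lt_of_csInf_lt (s := φ '' T x)
      (b := (φ x + sInf (φ '' T x)) / 2) ⟨_, mem_image_of_mem φ hd⟩ (by linarith)
    exact ⟨y, hy, hlt'.le, by linarith⟩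
  choose s hsT hs hslt using hnext
  obtain ⟨x₀⟩ := ‹Nonempty X›
  have hK : 0 ≤ K := by
    by_contra hK
    have h1 : dist x₀ (s x₀) ≤ K * (φ x₀ - φ (s x₀)) := hsT x₀
    nlinarith [hslt x₀, dist_nonneg (x := x₀) (y := s x₀)]
  let u : ℕ → X := fun k => s^[k] x₀
  have hu : ∀ k, u (k + 1) = s (u k) := fun k => Function.iterate_succ_apply' s k x₀
  have hanti : Antitone (φ ∘ u) := antitone_nat_of_succ_le fun k => by
    simpa only [Function.comp, hu] using (hslt (u k)).le
  have huT : ∀ k l, k ≤ l → u l ∈ T (u k) := by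
    intro k l hkl
    induction l, hkl using Nat.le_induction with
    | base => simp [T]
    | succ l _ ih => exact hTtrans ih (hu l ▸ hsT (u l))
  obtain ⟨m, hm⟩ : ∃ m, Tendsto (φ ∘ u) atTop (𝓝 m) :=
    ⟨_, tendsto_atTop_ciInf hanti ⟨0, by rintro _ ⟨k, rfl⟩; exact hpos _⟩⟩
  have hcau : CauchySeq u := by
    refine cauchySeq_of_le_tendsto_0' (fun k => K * ((φ ∘ u) k - m)) (fun k l hkl => ?_) ?_
    · have h1 : dist (u k) (u l) ≤ K * (φ (u k) - φ (u l)) := huT k l hkl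
      have h2 : m ≤ φ (u l) := hanti.le_of_tendsto hm l
      simp only [Function.comp]
      nlinarith
    · simpa using (hm.sub_const m).const_mul K
  obtain ⟨x, hx⟩ := cauchySeq_tendsto_of_complete hcau
  have hφx : φ x = m := tendsto_nhds_unique ((hφ.tendsto x).comp hx) hm
  have hxT : ∀ k, x ∈ T (u k) := fun k => by
    have h1 : Tendsto (fun l => dist (u k) (u l)) atTop (𝓝 (dist (u k) x)) :=
      tendsto_const_nhds.dist hx
    have h2 : Tendsto (fun l => K * (φ (u k) - (φ ∘ u) l)) atTop (𝓝 (K * (φ (u k) - m))) :=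
      (tendsto_const_nhds.sub hm).const_mul K
    change dist (u k) x ≤ K * (φ (u k) - φ x)
    rw [hφx]
    exact le_of_tendsto_of_tendsto h1 h2 (eventually_atTop.2 ⟨k, fun l hl => huT k l hl⟩)
  obtain ⟨x', hx', hd⟩ := hstep x (hne x)
  have hle : ∀ k, (φ ∘ u) (k + 1) ≤ ((φ ∘ u) k + φ x') / 2 := fun k => by
    have h1 : sInf (φ '' T (u k)) ≤ φ x' :=
      csInf_le (hbdd _) (mem_image_of_mem φ (hTtrans (hxT k) hd))
    have h2 := hs (u k)
    simp only [Function.comp, hu]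
    linarith
  have := le_of_tendsto_of_tendsto' (hm.comp (tendsto_add_atTop_nat 1))
    ((hm.add_const (φ x')).div_const 2) hle
  linarith

section LocalInverse

variable {E : Type*} [NormedAddCommGroup E] [NormedSpace ℝ E]
  {H : Type*} [TopologicalSpace H] {I : ModelWithCorners ℝ E H}
  {E' : Type*} [NormedAddCommGroup E'] [NormedSpace ℝ E']
  {H' : Type*} [TopologicalSpace H'] {I' : ModelWithCorners ℝ E' H'}
  {S : Type*} [TopologicalSpace S] [ChartedSpace H S] [IsManifold I 1 S]
  {M : Type*} [TopologicalSpace M] [ChartedSpace H' M] [IsManifold I' 1 M]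

theorem mem_boundary_iff_extChartAt_mem_frontier {x p : S} (hp : p ∈ (extChartAt I x).source) :
    p ∈ I.boundary S ↔ extChartAt I x p ∈ frontier (range I) := by
  have hp' : p ∈ (chartAt H x).source := by rwa [extChartAt_source] at hp
  have h1 : p ∈ I.interior S ↔ extChartAt I x p ∈ interior (range I) := by
    refine (I.isInteriorPoint_iff_of_mem_atlas one_ne_zero (chart_mem_atlas H x) hp').trans
      ⟨fun h => interior_mono ?_ h, fun h => ?_⟩
    · exact extChartAt_target_subset_range x
    · exact (chartAt H x).mem_interior_extend_target (by simp [hp']) h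
  rw [← I.compl_interior, mem_compl_iff, h1, I.isClosed_range.frontier_eq]
  exact ⟨fun h => ⟨extChartAt_target_subset_range x ((extChartAt I x).map_source hp), h⟩,
    fun h => h.2⟩

/-- The inverse function theorem for manifolds with boundary, for a map which respects the
boundaries. -/
theorem exists_contMDiffOn_localInverse [FiniteDimensional ℝ E] [FiniteDimensional ℝ E'] {f : S → M}
    (hf : ContMDiff I I' 1 f) {x : S}
    (hbij : Function.Bijective (mfderiv I I' f x))
    (hbd : ∀ z, f z ∈ I'.boundary M ↔ z ∈ I.boundary S) :
    ∃ (g : M → S) (V : Set M), IsOpen V ∧ f x ∈ V ∧ g (f x) = x ∧ (∀ y ∈ V, f (g y) = y) ∧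
      ContMDiffOn I' I 1 g V := by
  set φ := extChartAt I x
  set φ' := extChartAt I' (f x)
  have hcd := (contMDiff_iff.1 hf).2 x (f x)
  obtain ⟨U, hUo, hxU, hU⟩ : ∃ U : Set E, IsOpen U ∧ φ x ∈ U ∧
      U ∩ range I ⊆ φ.target ∩ φ.symm ⁻¹' (f ⁻¹' φ'.source) := by
    refine mem_nhdsWithin.1 (inter_mem (extChartAt_target_mem_nhdsWithin x) ?_)
    refine mem_nhdsWithin_of_mem_nhds (extChartAt_preimage_mem_nhds ?_)
    exact hf.continuous.continuousAt.preimage_mem_nhds (extChartAt_source_mem_nhds _)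
  rw [inter_comm] at hU
  let f' : E → E' := φ' ∘ f ∘ φ.symm
  have hf'x : f' (φ x) = φ' (f x) := by simp [f', φ]
  let A : E ≃L[ℝ] E' := ContinuousLinearEquiv.ofBijective
    (fderivWithin ℝ f' (range I) (φ x)) (by
      have : fderivWithin ℝ f' (range I) (φ x) = mfderiv I I' f x :=
        (hf.mdifferentiableAt one_ne_zero).mfderiv.symm
      rw [this]; exact LinearMap.ker_eq_bot.2 hbij.1) (by
      have : fderivWithin ℝ f' (range I) (φ x) = mfderiv I I' f x :=
        (hf.mdifferentiableAt one_ne_zero).mfderiv.symm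
      rw [this]; exact LinearMap.range_eq_top.2 hbij.2)
  obtain ⟨g, V, hVo, hxV, hgx, hgm, hfg, hg⟩ := exists_contDiffOn_localInverse
    (R := range I) (R' := range I') (f := f') (x₀ := φ x) I.isClosed_range I.convex_range
    I.nonempty_interior I'.isClosed_range I'.convex_range I'.nonempty_interior hUo
    ⟨mem_range_self _, hxU⟩ (hcd.mono hU) A rfl
    (fun z hz => extChartAt_target_subset_range _ (φ'.map_source (hU hz).2))
    (fun z hz => by
      have h1 := mem_boundary_iff_extChartAt_mem_frontier (I := I') (hU hz).2
      have h2 := mem_boundary_iff_extChartAt_mem_frontier (I := I) (φ.map_target (hU hz).1)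
      rw [show extChartAt I x (φ.symm z) = z from φ.right_inv (hU hz).1] at h2
      exact h1.symm.trans ((hbd _).trans h2))
  rw [hf'x] at hxV hgx
  have hmem : ∀ y ∈ φ'.source ∩ φ' ⁻¹' V, φ' y ∈ range I' ∩ V := fun y hy =>
    ⟨extChartAt_target_subset_range _ (φ'.map_source hy.1), hy.2⟩
  refine ⟨φ.symm ∘ g ∘ φ', φ'.source ∩ φ' ⁻¹' V, isOpen_extChartAt_preimage' (f x) hVo,
    ⟨mem_extChartAt_source _, hxV⟩, by simp [hgx, φ], fun y hy => ?_, ?_⟩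
  · have h1 := hfg _ (hmem y hy)
    exact φ'.injOn (hU (hgm (hmem y hy))).2 hy.1 h1
  · refine (contMDiffOn_extChartAt_symm (I := I) (n := 1) x).comp (t := φ.target) ?_
      fun y hy => (hU (hgm (hmem y hy))).1
    refine (contMDiffOn_iff_contDiffOn.2 hg).comp (t := range I' ∩ V) ?_ hmem
    exact (contMDiffOn_extChartAt (I := I') (n := 1)).mono fun y hy => by
      simpa [φ', extChartAt_source] using hy.1

end LocalInverse

section LocalIsometry

open scoped ENNReal

variable {E : Type*} [NormedAddCommGroup E] [NormedSpace ℝ E]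
  {H : Type*} [TopologicalSpace H] {I : ModelWithCorners ℝ E H}
  {S : Type*} [MetricSpace S] [ChartedSpace H S]
  [RiemannianBundle (fun x : S => TangentSpace I x)] [IsRiemannianManifold I S]
  {M : Type*} [MetricSpace M] [ChartedSpace H M]
  [RiemannianBundle (fun x : M => TangentSpace I x)] [IsRiemannianManifold I M]

/-- A `C¹` path between two points of a Riemannian manifold, of length close to the distance. -/
theorem exists_path_length_lt {x y : M} {r : ℝ≥0∞} (hr : edist x y < r) :
    ∃ γ : ℝ → M, γ 0 = x ∧ γ 1 = y ∧ ContMDiffOn 𝓘(ℝ, ℝ) I 1 γ (Icc 0 1) ∧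
      pathELength I γ 0 1 < r := by
  rw [IsRiemannianManifold.out (I := I) x y] at hr
  exact exists_lt_of_riemannianEDist_lt hr

theorem edist_le_pathELength {γ : ℝ → M} {a b : ℝ}
    (hγ : ContMDiffOn 𝓘(ℝ, ℝ) I 1 γ (Icc a b)) (hab : a ≤ b) :
    edist (γ a) (γ b) ≤ pathELength I γ a b := by
  rw [IsRiemannianManifold.out (I := I)]
  exact riemannianEDist_le_pathELength hγ rfl rfl hab

variable [FiniteDimensional ℝ E] [IsManifold I 1 S] [IsManifold I 1 M]

/-- Along a local isometry, points close to `f x` lift to points close to `x`, with a uniform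
control of the distance. -/
theorem exists_lift_dist_le {f : S → M} (hf : ContMDiff I I 1 f)
    (hiso : ∀ x (v : TangentSpace I x), ‖mfderiv I I f x v‖ = ‖v‖)
    (hbd : ∀ z, f z ∈ I.boundary M ↔ z ∈ I.boundary S) (x : S) :
    ∃ δ > 0, ∀ y, dist (f x) y < δ → ∃ x', f x' = y ∧ dist x x' ≤ 2 * dist (f x) y := by
  have hinj : Function.Injective (mfderiv I I f x) := by
    refine (injective_iff_map_eq_zero _).2 fun v hv => ?_
    have := hiso x v
    rw [hv, norm_zero] at this
    exact norm_eq_zero.1 this.symm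
  have hbij : Function.Bijective (mfderiv I I f x) :=
    ⟨hinj, (LinearMap.injective_iff_surjective_of_finrank_eq_finrank
      (f := (mfderiv I I f x).toLinearMap) rfl).1 hinj⟩
  obtain ⟨g, V, hVo, hxV, hgx, hfg, hg⟩ := exists_contMDiffOn_localInverse hf hbij hbd
  obtain ⟨δ, hδ, hδV⟩ := Metric.isOpen_iff.1 hVo _ hxV
  refine ⟨δ, hδ, fun y hy => ?_⟩
  rcases eq_or_ne (f x) y with rfl | hne
  · exact ⟨x, rfl, by simp⟩
  have hd : 0 < dist (f x) y := dist_pos.2 hne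
  obtain ⟨γ, hγ0, hγ1, hγ, hlen⟩ := exists_path_length_lt (I := I) (x := f x) (y := y)
    (r := ENNReal.ofReal (min δ (2 * dist (f x) y))) (by
      rw [edist_dist]
      exact (ENNReal.ofReal_lt_ofReal_iff (lt_min hδ (by linarith))).2 (lt_min hy (by linarith)))
  have hγV : ∀ t ∈ Icc (0 : ℝ) 1, γ t ∈ V := fun t ht => by
    apply hδV
    have h1 := edist_le_pathELength (hγ.mono (Icc_subset_Icc_right ht.2)) ht.1
    have h2 : edist (f x) (γ t) < ENNReal.ofReal δ := by
      rw [hγ0] at h1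
      refine (h1.trans (pathELength_mono le_rfl ht.2)).trans_lt (hlen.trans_le ?_)
      exact ENNReal.ofReal_le_ofReal (min_le_left _ _)
    rw [edist_dist, ENNReal.ofReal_lt_ofReal_iff hδ] at h2
    rwa [mem_ball']
  have hc : ContMDiffOn 𝓘(ℝ, ℝ) I 1 (g ∘ γ) (Icc 0 1) := hg.comp hγ hγV
  have hlen' : pathELength I (g ∘ γ) 0 1 = pathELength I γ 0 1 := by
    rw [← pathELength_congr (γ := f ∘ (g ∘ γ)) (γ' := γ) fun t ht => hfg _ (hγV t ht),
      pathELength_eq_lintegral_mfderivWithin_Icc, pathELength_eq_lintegral_mfderivWithin_Icc]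
    refine MeasureTheory.setLIntegral_congr_fun measurableSet_Icc fun t ht => ?_
    have hu : UniqueMDiffWithinAt 𝓘(ℝ, ℝ) (Icc (0 : ℝ) 1) t :=
      uniqueMDiffWithinAt_iff_uniqueDiffWithinAt.2 (uniqueDiffOn_Icc zero_lt_one t ht)
    have h1 : mfderivWithin 𝓘(ℝ, ℝ) I (f ∘ (g ∘ γ)) (Icc 0 1) t =
        (mfderiv I I f (g (γ t))).comp (mfderivWithin 𝓘(ℝ, ℝ) I (g ∘ γ) (Icc 0 1) t) :=
      mfderiv_comp_mfderivWithin t (hf.mdifferentiableAt one_ne_zero)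
        (hc.mdifferentiableOn one_ne_zero t ht) hu
    have h2 : mfderivWithin 𝓘(ℝ, ℝ) I (f ∘ (g ∘ γ)) (Icc 0 1) t 1 =
        mfderiv I I f (g (γ t)) (mfderivWithin 𝓘(ℝ, ℝ) I (g ∘ γ) (Icc 0 1) t 1) := congr($h1 1)
    rw [h2, ← ofReal_norm, ← ofReal_norm]
    exact congrArg ENNReal.ofReal (hiso (g (γ t)) _).symm
  refine ⟨g y, hfg y (hδV (mem_ball'.2 hy)), ?_⟩
  have h1 := edist_le_pathELength hc zero_le_one
  rw [hlen', Function.comp, Function.comp, hγ0, hγ1, hgx] at h1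
  have h2 : edist x (g y) ≤ ENNReal.ofReal (2 * dist (f x) y) :=
    h1.trans (hlen.le.trans (ENNReal.ofReal_le_ofReal (min_le_right _ _)))
  rwa [edist_dist, ENNReal.ofReal_le_ofReal_iff (by positivity)] at h2

/-- A local isometry from a complete Riemannian manifold which respects the boundaries is
surjective. -/
theorem surjective_of_local_isometry [CompleteSpace S] [Nonempty S] {f : S → M}
    (hf : ContMDiff I I 1 f) (hiso : ∀ x (v : TangentSpace I x), ‖mfderiv I I f x v‖ = ‖v‖)
    (hbd : ∀ z, f z ∈ I.boundary M ↔ z ∈ I.boundary S) : Function.Surjective f := by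
  intro q
  suffices h : ∃ x, dist (f x) q = 0 by
    obtain ⟨x, hx⟩ := h
    exact ⟨x, dist_eq_zero.1 hx⟩
  refine exists_eq_zero_of_decreasing_step (K := 4) (hf.continuous.dist continuous_const)
    (fun _ => dist_nonneg) fun x hx => ?_
  have hD : 0 < dist (f x) q := dist_nonneg.lt_of_ne' hx
  obtain ⟨δ, hδ, hlift⟩ := exists_lift_dist_le hf hiso hbd x
  obtain ⟨ρ, hρ0, hρ⟩ := exists_between (lt_min hδ hD)
  have hρδ := hρ.trans_le (min_le_left _ _)
  have hρD := hρ.trans_le (min_le_right _ _)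
  obtain ⟨γ, hγ0, hγ1, hγ, hlen⟩ := exists_path_length_lt (I := I) (x := f x) (y := q)
    (r := ENNReal.ofReal (dist (f x) q + ρ / 2)) (by
      rw [edist_dist]
      exact (ENNReal.ofReal_lt_ofReal_iff (by linarith)).2 (by linarith))
  obtain ⟨τ, hτ, hτρ⟩ : ∃ τ ∈ Icc (0 : ℝ) 1, dist (f x) (γ τ) = ρ := by
    have hcont : ContinuousOn (fun t => dist (f x) (γ t)) (Icc 0 1) :=
      (continuous_const.dist continuous_id).comp_continuousOn hγ.continuousOn
    refine intermediate_value_Icc zero_le_one hcont ⟨?_, ?_⟩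
    · simp [hγ0, hρ0.le]
    · simp [hγ1, hρD.le]
  obtain ⟨x', hx', hdist⟩ := hlift (γ τ) (by rw [hτρ]; exact hρδ)
  have h1 := edist_le_pathELength (hγ.mono (Icc_subset_Icc_right hτ.2)) hτ.1
  have h2 := edist_le_pathELength (hγ.mono (Icc_subset_Icc_left hτ.1)) hτ.2
  have h3 : dist (f x) (γ τ) + dist (γ τ) q < dist (f x) q + ρ / 2 := by
    rw [← ENNReal.ofReal_lt_ofReal_iff (by linarith),
      ENNReal.ofReal_add dist_nonneg dist_nonneg, ← edist_dist, ← edist_dist]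
    refine lt_of_le_of_lt ?_ hlen
    rw [← pathELength_add hτ.1 hτ.2]
    rw [hγ0] at h1
    rw [hγ1] at h2
    exact add_le_add h1 h2
  refine ⟨x', ?_, ?_⟩
  · rw [hx']; linarith
  · rw [hx']; rw [hτρ] at hdist; linarith

end LocalIsometry

section BilinearFamilies

variable {W : Type*} [NormedAddCommGroup W] [NormedSpace ℝ W] [FiniteDimensional ℝ W]
  {E : Type*} [NormedAddCommGroup E] [NormedSpace ℝ E]

theorem hasFDerivWithinAt_bilinear_family_aux {g : W → W → W → ℝ}
    (hg : ∀ y, ∃ B : W →ₗ[ℝ] W →ₗ[ℝ] ℝ, ∀ v w, B v w = g v w y)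
    {f A B : E → W} {R : Set E} {R' : Set W} {z : E}
    (hd : ∀ v w, DifferentiableWithinAt ℝ (g v w) R' (f z)) (hf : DifferentiableWithinAt ℝ f R z)
    (hA : DifferentiableWithinAt ℝ A R z) (hB : DifferentiableWithinAt ℝ B R z)
    (hm : ∀ᶠ y in 𝓝[R] z, f y ∈ R') :
    ∃ L : E →L[ℝ] ℝ, HasFDerivWithinAt (fun y => g (A y) (B y) (f y)) L R z ∧ ∀ u, L u =
      ∑ i, ∑ j, (Module.finBasis ℝ W).repr (A z) i * (Module.finBasis ℝ W).repr (B z) j *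
          fderivWithin ℝ (g (Module.finBasis ℝ W i) (Module.finBasis ℝ W j)) R' (f z)
            (fderivWithin ℝ f R z u)
        + g (fderivWithin ℝ A R z u) (B z) (f z) + g (A z) (fderivWithin ℝ B R z u) (f z) := by
  let b := Module.finBasis ℝ W
  let c : Fin (Module.finrank ℝ W) → W →L[ℝ] ℝ := fun i => (b.coord i).toContinuousLinearMap
  have hexp : ∀ v w y, g v w y = ∑ i, ∑ j, c i v * c j w * g (b i) (b j) y := fun v w y => by
    obtain ⟨B, hB⟩ := hg y
    rw [← hB v w, ← LinearMap.sum_repr_mul_repr_mul b b v w, Finsupp.sum_fintype _ _ (by simp)]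
    refine Finset.sum_congr rfl fun i _ => ?_
    rw [Finsupp.sum_fintype _ _ (by simp)]
    refine Finset.sum_congr rfl fun j _ => ?_
    simp only [hB, c, LinearMap.coe_toContinuousLinearMap', Module.Basis.coord_apply, smul_eq_mul]
    ring
  have h1 : ∀ i j, HasFDerivWithinAt (fun y => g (b i) (b j) (f y))
      ((fderivWithin ℝ (g (b i) (b j)) R' (f z)).comp (fderivWithin ℝ f R z)) R z := fun i j => by
    have h2 : HasFDerivWithinAt (fun y => g (b i) (b j) (f y))
        ((fderivWithin ℝ (g (b i) (b j)) R' (f z)).comp (fderivWithin ℝ f R z))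
        (R ∩ {y | f y ∈ R'}) z :=
      (hd _ _).hasFDerivWithinAt.comp z (hf.hasFDerivWithinAt.mono inter_subset_left)
        fun y hy => hy.2
    exact h2.mono_of_mem_nhdsWithin (inter_mem self_mem_nhdsWithin hm)
  have hcA : ∀ i, HasFDerivWithinAt (fun y => c i (A y)) ((c i).comp (fderivWithin ℝ A R z)) R z :=
    fun i => (c i).hasFDerivAt.comp_hasFDerivWithinAt z hA.hasFDerivWithinAt
  have hcB : ∀ i, HasFDerivWithinAt (fun y => c i (B y)) ((c i).comp (fderivWithin ℝ B R z)) R z :=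
    fun i => (c i).hasFDerivAt.comp_hasFDerivWithinAt z hB.hasFDerivWithinAt
  have h3 := HasFDerivWithinAt.fun_sum fun i (_ : i ∈ Finset.univ) =>
    HasFDerivWithinAt.fun_sum fun j (_ : j ∈ Finset.univ) =>
      ((hcA i).mul (hcB j)).mul (h1 i j)
  refine ⟨_, h3.congr (fun y _ => hexp _ _ _) (hexp _ _ _), fun u => ?_⟩
  rw [hexp (fderivWithin ℝ A R z u), hexp (A z) (fderivWithin ℝ B R z u)]
  simp only [_root_.sum_apply, _root_.add_apply, _root_.smul_apply,
    ContinuousLinearMap.comp_apply, smul_eq_mul, Pi.mul_apply, ← Finset.sum_add_distrib]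
  refine Finset.sum_congr rfl fun i _ => Finset.sum_congr rfl fun j _ => ?_
  simp only [c, b, LinearMap.coe_toContinuousLinearMap', Module.Basis.coord_apply]
  ring

/-- The product rule for `z ↦ g (A z) (B z) (f z)`, where `g` is a family of bilinear forms, given
by its coefficients `y ↦ g v w y`. -/
theorem fderivWithin_bilinear_family {g : W → W → W → ℝ}
    (hg : ∀ y, ∃ B : W →ₗ[ℝ] W →ₗ[ℝ] ℝ, ∀ v w, B v w = g v w y)
    {f A B : E → W} {R : Set E} {R' : Set W} {z : E} (hz : UniqueDiffWithinAt ℝ R z)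
    (hz' : UniqueDiffWithinAt ℝ R' (f z))
    (hd : ∀ v w, DifferentiableWithinAt ℝ (g v w) R' (f z)) (hf : DifferentiableWithinAt ℝ f R z)
    (hA : DifferentiableWithinAt ℝ A R z) (hB : DifferentiableWithinAt ℝ B R z)
    (hm : ∀ᶠ y in 𝓝[R] z, f y ∈ R') (u : E) :
    fderivWithin ℝ (fun y => g (A y) (B y) (f y)) R z u =
      fderivWithin ℝ (g (A z) (B z)) R' (f z) (fderivWithin ℝ f R z u)
        + g (fderivWithin ℝ A R z u) (B z) (f z) + g (A z) (fderivWithin ℝ B R z u) (f z) := by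
  obtain ⟨L, hL, hLu⟩ := hasFDerivWithinAt_bilinear_family_aux hg hd hf hA hB hm
  obtain ⟨L', hL', hLu'⟩ := hasFDerivWithinAt_bilinear_family_aux hg (f := id) (R := R') (R' := R')
    (z := f z) hd differentiableWithinAt_id (differentiableWithinAt_const (A z))
    (differentiableWithinAt_const (B z)) self_mem_nhdsWithin
  have h0 : ∀ w y, g 0 w y = 0 ∧ g w 0 y = 0 := fun w y => by
    obtain ⟨B, hB⟩ := hg y
    simp [← hB]
  have h1 : fderivWithin ℝ (g (A z) (B z)) R' (f z) = L' := hL'.fderivWithin hz'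
  rw [hL.fderivWithin hz, hLu, h1, hLu']
  simp [fderivWithin_id hz', h0]

end BilinearFamilies

section CoordinateMetric

variable {E : Type*} [NormedAddCommGroup E] [NormedSpace ℝ E]
  {H : Type*} [TopologicalSpace H] {I : ModelWithCorners ℝ E H}
  {P : Type*} [TopologicalSpace P] [ChartedSpace H P]

theorem coordMetric_self [IsManifold I 1 P] (g : ∀ x : P, TangentSpace I x → TangentSpace I x → ℝ)
    (x : P) (v w : TangentSpace I x) :
    coordMetric g x v w (extChartAt I x x) = g x v w := by
  have h := mfderivWithin_range_extChartAt_symm (I := I) (x := x)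
  have h1 : ∀ v : E, (mfderivWithin 𝓘(ℝ, E) I (extChartAt I x).symm (range I) (extChartAt I x x) v
      : E) = v := fun v => congr($h v)
  unfold coordMetric
  have h2 : (extChartAt I x).symm (extChartAt I x x) = x := by simp
  have h3 : ∀ p : P, p = x → ∀ v' w' : E, v' = v → w' = w →
      g p (show TangentSpace I p from v') (show TangentSpace I p from w') = g x v w := by
    rintro p rfl v' w' rfl rfl
    rfl
  exact h3 _ h2 _ _ (h1 v) (h1 w)

theorem trivializationAt_tangent_snd [IsManifold I 1 P] {x p : P} (hp : p ∈ (chartAt H x).source)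
    (X : TangentSpace I p) :
    (trivializationAt E (TangentSpace I) x (⟨p, X⟩ : TangentBundle I P)).2 =
      mfderiv I 𝓘(ℝ, E) (extChartAt I x) p X := by
  rw [← TangentBundle.continuousLinearMapAt_trivializationAt hp]
  exact congr($((trivializationAt E (TangentSpace I) x).coe_linearMapAt_of_mem (R := ℝ)
    (by simpa using hp)) X).symm

theorem exists_bilinear_inner_comp {V V' : Type*} [AddCommGroup V] [Module ℝ V]
    [NormedAddCommGroup V'] [InnerProductSpace ℝ V'] (L : V →ₗ[ℝ] V') :
    ∃ B : V →ₗ[ℝ] V →ₗ[ℝ] ℝ, ∀ v w, B v w = inner ℝ (L v) (L w) :=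
  ⟨(innerₗ V').compl₁₂ L L, fun _ _ => rfl⟩

variable [RiemannianBundle (fun x : P => TangentSpace I x)]

theorem coordMetric_metricTensor_bilinear (x : P) (y : E) :
    ∃ B : E →ₗ[ℝ] E →ₗ[ℝ] ℝ, ∀ v w, B v w = coordMetric (metricTensor I) x v w y := by
  exact exists_bilinear_inner_comp (mfderivWithin 𝓘(ℝ, E) I (extChartAt I x).symm (range I)
    y).toLinearMap

theorem differentiableWithinAt_coordMetric [IsManifold I ∞ P]
    [IsContMDiffRiemannianBundle I ∞ E (fun x : P => TangentSpace I x)] (x : P) (v w : E) :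
    DifferentiableWithinAt ℝ (coordMetric (metricTensor I) x v w) (range I) (extChartAt I x x) := by
  have key : ∀ v : E, ContMDiffWithinAt 𝓘(ℝ, E) (I.prod 𝓘(ℝ, E)) 1
      (fun y => (⟨(extChartAt I x).symm y,
        mfderivWithin 𝓘(ℝ, E) I (extChartAt I x).symm (range I) y v⟩ :
          TotalSpace E (fun x : P => TangentSpace I x)))
      (range I) (extChartAt I x x) := by
    intro v
    rw [contMDiffWithinAt_totalSpace]
    refine ⟨contMDiffWithinAt_extChartAt_symm_range x (mem_extChartAt_target x), ?_⟩
    refine ContMDiffWithinAt.congr_of_eventuallyEq_of_mem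
      (contMDiffWithinAt_const (c := v)) ?_ (mem_range_self _)
    filter_upwards [extChartAt_target_mem_nhdsWithin x] with y hy
    have hy' : (extChartAt I x).symm y ∈ (chartAt H x).source := by
      rw [← extChartAt_source I]; exact (extChartAt I x).map_target hy
    rw [extChartAt_to_inv, trivializationAt_tangent_snd hy']
    exact congr($(mfderiv_extChartAt_comp_mfderivWithin_extChartAt_symm (I := I) hy) v)
  have := ContMDiffWithinAt.inner_bundle (IB := I) (n := 1) (F := E)
    (E := fun x : P => TangentSpace I x) (b := (extChartAt I x).symm)
    (v := fun y => mfderivWithin 𝓘(ℝ, E) I (extChartAt I x).symm (range I) y v)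
    (w := fun y => mfderivWithin 𝓘(ℝ, E) I (extChartAt I x).symm (range I) y w) (key v) (key w)
  exact (contMDiffWithinAt_iff_contDiffWithinAt.1 this).differentiableWithinAt one_ne_zero

end CoordinateMetric

section CylinderMetric

variable {n : ℕ} [NeZero n]
  {M : Type*} [TopologicalSpace M] [ChartedSpace (EuclideanHalfSpace n) M]

theorem extChartAt_cyl_symm (y : M × ℝ) :
    ((extChartAt (cylModel n) y).symm : EuclideanSpace ℝ (Fin n) × ℝ → M × ℝ) =
      Prod.map (extChartAt (𝓡∂ n) y.1).symm id := by
  rw [extChartAt_prod, extChartAt_model_space_eq_id]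
  rfl

theorem range_cylModel : range (cylModel n) = range (𝓡∂ n) ×ˢ (univ : Set ℝ) := by
  rw [ModelWithCorners.range_prod]; simp

theorem mem_cyl_target {y : M × ℝ} {Y : EuclideanSpace ℝ (Fin n) × ℝ} :
    Y ∈ (extChartAt (cylModel n) y).target ↔ Y.1 ∈ (extChartAt (𝓡∂ n) y.1).target := by
  rw [extChartAt_prod, extChartAt_model_space_eq_id, PartialEquiv.prod_target]
  simp only [PartialEquiv.refl_target, mem_prod, mem_univ, and_true]

theorem mfderivWithin_cyl_symm [IsManifold (𝓡∂ n) 1 M] {y : M × ℝ}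
    {Y : EuclideanSpace ℝ (Fin n) × ℝ} (hY : Y ∈ (extChartAt (cylModel n) y).target)
    (V : EuclideanSpace ℝ (Fin n) × ℝ) :
    (mfderivWithin 𝓘(ℝ, EuclideanSpace ℝ (Fin n) × ℝ) (cylModel n)
        (extChartAt (cylModel n) y).symm (range (cylModel n)) Y V :
          EuclideanSpace ℝ (Fin n) × ℝ) =
      ((mfderivWithin 𝓘(ℝ, EuclideanSpace ℝ (Fin n)) (𝓡∂ n) (extChartAt (𝓡∂ n) y.1).symm
        (range (𝓡∂ n)) Y.1 V.1 : EuclideanSpace ℝ (Fin n)), V.2) := by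
  have hY' := mem_cyl_target.1 hY
  have h3 := mfderivWithin_prodMap (p := Y) (s := range (𝓡∂ n)) (t := univ) (g := (id : ℝ → ℝ))
    (mdifferentiableWithinAt_extChartAt_symm hY')
    (mdifferentiableAt_id (I := 𝓘(ℝ, ℝ))).mdifferentiableWithinAt
    ((𝓡∂ n).uniqueMDiffOn _ (extChartAt_target_subset_range _ hY')) (uniqueMDiffWithinAt_univ 𝓘(ℝ, ℝ))
  rw [mfderivWithin_univ, mfderiv_id] at h3
  rw [extChartAt_cyl_symm, range_cylModel, modelWithCornersSelf_prod, ← chartedSpaceSelf_prod]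
  exact congr($h3 V)

variable [RiemannianBundle (fun x : M => TangentSpace (𝓡∂ n) x)]

theorem coordMetric_cyl [IsManifold (𝓡∂ n) 1 M] {y : M × ℝ}
    {Y : EuclideanSpace ℝ (Fin n) × ℝ} (hY : Y ∈ (extChartAt (cylModel n) y).target)
    (V W : EuclideanSpace ℝ (Fin n) × ℝ) :
    coordMetric cylMetric y V W Y =
      coordMetric (metricTensor (𝓡∂ n)) y.1 V.1 W.1 Y.1 + V.2 * W.2 := by
  have hV := mfderivWithin_cyl_symm hY V
  have hW := mfderivWithin_cyl_symm hY W
  have hp : (extChartAt (cylModel n) y).symm Y = ((extChartAt (𝓡∂ n) y.1).symm Y.1, Y.2) := by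
    rw [extChartAt_cyl_symm]; rfl
  have h3 : ∀ p p' : M × ℝ, p = p' → ∀ v w v' w' : EuclideanSpace ℝ (Fin n) × ℝ, v = v' → w = w' →
      cylMetric p (show TangentSpace (cylModel n) p from v) (show TangentSpace (cylModel n) p from w)
      = cylMetric p' (show TangentSpace (cylModel n) p' from v')
        (show TangentSpace (cylModel n) p' from w') := by
    rintro p _ rfl v w _ _ rfl rfl; rfl
  exact h3 _ _ hp _ _ _ _ hV hW

theorem exists_bilinear_cylMetric (y : M × ℝ) :
    ∃ B : TangentSpace (cylModel n) y →ₗ[ℝ] TangentSpace (cylModel n) y →ₗ[ℝ] ℝ,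
      ∀ v w, B v w = cylMetric y v w := by
  let L : TangentSpace (cylModel n) y →ₗ[ℝ] TangentSpace (𝓡∂ n) y.1 :=
    LinearMap.fst ℝ (EuclideanSpace ℝ (Fin n)) ℝ
  let L' : TangentSpace (cylModel n) y →ₗ[ℝ] ℝ := LinearMap.snd ℝ (EuclideanSpace ℝ (Fin n)) ℝ
  exact ⟨(innerₗ (TangentSpace (𝓡∂ n) y.1)).compl₁₂ L L + (LinearMap.mul ℝ ℝ).compl₁₂ L' L',
    fun _ _ => rfl⟩

theorem coordMetric_cyl_bilinear (y : M × ℝ) (Y : EuclideanSpace ℝ (Fin n) × ℝ) :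
    ∃ B : (EuclideanSpace ℝ (Fin n) × ℝ) →ₗ[ℝ] (EuclideanSpace ℝ (Fin n) × ℝ) →ₗ[ℝ] ℝ,
      ∀ v w, B v w = coordMetric cylMetric y v w Y := by
  obtain ⟨B, hB⟩ := exists_bilinear_cylMetric (n := n) ((extChartAt (cylModel n) y).symm Y)
  let L := (mfderivWithin 𝓘(ℝ, EuclideanSpace ℝ (Fin n) × ℝ) (cylModel n)
        (extChartAt (cylModel n) y).symm (range (cylModel n)) Y).toLinearMap
  exact ⟨B.compl₁₂ L L, fun v w => hB _ _⟩

theorem dMetric_zero {x : M} (u v w : EuclideanSpace ℝ (Fin n)) :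
    dMetric (metricTensor (𝓡∂ n)) x 0 v w = 0 ∧ dMetric (metricTensor (𝓡∂ n)) x u 0 w = 0 ∧
      dMetric (metricTensor (𝓡∂ n)) x u v 0 = 0 := by
  have h0 : ∀ w, coordMetric (metricTensor (𝓡∂ n)) x 0 w = (fun _ => 0) ∧
      coordMetric (metricTensor (𝓡∂ n)) x w 0 = fun _ => 0 := fun w => by
    refine ⟨funext fun y => ?_, funext fun y => ?_⟩ <;>
    · obtain ⟨B, hB⟩ := coordMetric_metricTensor_bilinear (I := 𝓡∂ n) x y
      rw [← hB]; simp
  refine ⟨by simp [dMetric], ?_, ?_⟩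
  · rw [dMetric, (h0 w).1]; simp
  · rw [dMetric, (h0 v).2]; simp

variable [IsManifold (𝓡∂ n) ∞ M]
  [IsContMDiffRiemannianBundle (𝓡∂ n) ∞ (EuclideanSpace ℝ (Fin n))
    (fun x : M => TangentSpace (𝓡∂ n) x)]

theorem hasFDerivWithinAt_coordMetric_cyl (y : M × ℝ) (V W : EuclideanSpace ℝ (Fin n) × ℝ) :
    HasFDerivWithinAt (coordMetric cylMetric y V W)
      ((fderivWithin ℝ (coordMetric (metricTensor (𝓡∂ n)) y.1 V.1 W.1) (range (𝓡∂ n))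
        (extChartAt (𝓡∂ n) y.1 y.1)).comp (ContinuousLinearMap.fst ℝ _ ℝ))
      (range (cylModel n)) (extChartAt (cylModel n) y y) := by
  have hq := (differentiableWithinAt_coordMetric (I := 𝓡∂ n) y.1 V.1 W.1).hasFDerivWithinAt
  have h1 : (extChartAt (cylModel n) y y).1 = extChartAt (𝓡∂ n) y.1 y.1 := by
    rw [extChartAt_prod]; rfl
  rw [← h1] at hq
  have h2 := (hq.comp (extChartAt (cylModel n) y y) (s := range (cylModel n))
    (ContinuousLinearMap.fst ℝ (EuclideanSpace ℝ (Fin n)) ℝ).hasFDerivWithinAt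
    (fun z hz => by rw [range_cylModel] at hz; exact hz.1)).add_const (V.2 * W.2)
  rw [h1] at h2
  refine h2.congr_of_eventuallyEq ?_ (coordMetric_cyl (mem_extChartAt_target y) V W)
  filter_upwards [extChartAt_target_mem_nhdsWithin y] with Y hY
  exact coordMetric_cyl hY V W

theorem dMetric_cyl (y : M × ℝ) (U V W : EuclideanSpace ℝ (Fin n) × ℝ) :
    dMetric cylMetric y U V W = dMetric (metricTensor (𝓡∂ n)) y.1 U.1 V.1 W.1 := by
  unfold dMetric
  rw [(hasFDerivWithinAt_coordMetric_cyl y V W).fderivWithin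
    ((cylModel n).uniqueDiffOn _ (mem_range_self _))]
  rfl

theorem christoffel_cyl_xi (y : M × ℝ) (U V : EuclideanSpace ℝ (Fin n) × ℝ) (c : ℝ) :
    christoffel cylMetric y U V (0, c) = 0 ∧ christoffel cylMetric y U (0, c) V = 0 := by
  simp only [christoffel, dMetric_cyl]
  simp [(dMetric_zero 0 _ _).1, (dMetric_zero _ 0 _).2.1, (dMetric_zero _ _ 0).2.2]

end CylinderMetric

/-- The metric coefficients in a chart, evaluated on the images of tangent vectors. -/
theorem coordMetric_mfderiv {E : Type*} [NormedAddCommGroup E] [NormedSpace ℝ E]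
    {H : Type*} [TopologicalSpace H] {I : ModelWithCorners ℝ E H}
    {P : Type*} [TopologicalSpace P] [ChartedSpace H P] [IsManifold I 1 P]
    (g : ∀ x : P, TangentSpace I x → TangentSpace I x → ℝ) {x p : P}
    (hp : p ∈ (extChartAt I x).source) (X Y : TangentSpace I p) :
    coordMetric g x (mfderiv I 𝓘(ℝ, E) (extChartAt I x) p X)
      (mfderiv I 𝓘(ℝ, E) (extChartAt I x) p Y) (extChartAt I x p) = g p X Y := by
  have h := mfderivWithin_extChartAt_symm_comp_mfderiv_extChartAt' (I := I) hp
  have h1 : ∀ v : TangentSpace I p, (mfderivWithin 𝓘(ℝ, E) I (extChartAt I x).symm (range I)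
      (extChartAt I x p) (mfderiv I 𝓘(ℝ, E) (extChartAt I x) p v) : E) = v := fun v => congr($h v)
  unfold coordMetric
  have h2 : (extChartAt I x).symm (extChartAt I x p) = p := (extChartAt I x).left_inv hp
  have h3 : ∀ q : P, q = p → ∀ v' w' : E, v' = X → w' = Y →
      g q (show TangentSpace I q from v') (show TangentSpace I q from w') = g p X Y := by
    rintro q rfl v' w' rfl rfl
    rfl
  exact h3 _ h2 _ _ (h1 X) (h1 Y)

section Hypersurface

variable {n : ℕ} [NeZero n]
  {M : Type*} [TopologicalSpace M] [ChartedSpace (EuclideanHalfSpace n) M]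
  {S : Type*} [TopologicalSpace S] [ChartedSpace (EuclideanHalfSpace n) S]

/-- The expression of `F` in the preferred charts at `x` and `F x`. -/
noncomputable def chartMap (F : S → M × ℝ) (x : S) :
    EuclideanSpace ℝ (Fin n) → EuclideanSpace ℝ (Fin n) × ℝ :=
  extChartAt (cylModel n) (F x) ∘ F ∘ (extChartAt (𝓡∂ n) x).symm

/-- The domain of the expression of `F` in the preferred charts at `x` and `F x`. -/
noncomputable def chartDomain (F : S → M × ℝ) (x : S) : Set (EuclideanSpace ℝ (Fin n)) :=
  (extChartAt (𝓡∂ n) x).target ∩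
    (extChartAt (𝓡∂ n) x).symm ⁻¹' (F ⁻¹' (extChartAt (cylModel n) (F x)).source)

theorem chartDomain_mem_nhdsWithin {F : S → M × ℝ} (hF : Continuous F) (x : S) :
    chartDomain F x ∈ 𝓝[range (𝓡∂ n)] (extChartAt (𝓡∂ n) x x) := by
  refine inter_mem (extChartAt_target_mem_nhdsWithin x) ?_
  refine mem_nhdsWithin_of_mem_nhds (extChartAt_preimage_mem_nhds ?_)
  exact hF.continuousAt.preimage_mem_nhds (extChartAt_source_mem_nhds _)

theorem chartMap_self (F : S → M × ℝ) (x : S) :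
    chartMap F x (extChartAt (𝓡∂ n) x x) = extChartAt (cylModel n) (F x) (F x) := by
  simp only [chartMap, Function.comp, extChartAt_to_inv]

theorem contDiffWithinAt_chartMap {F : S → M × ℝ} (hF : ContMDiff (𝓡∂ n) (cylModel n) ∞ F)
    (x : S) : ContDiffWithinAt ℝ ∞ (chartMap F x) (range (𝓡∂ n)) (extChartAt (𝓡∂ n) x x) :=
  (contMDiffAt_iff.1 (hF x)).2

theorem fderivWithin_chartMap_self {F : S → M × ℝ} (hF : ContMDiff (𝓡∂ n) (cylModel n) ∞ F)
    (x : S) (v : TangentSpace (𝓡∂ n) x) :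
    fderivWithin ℝ (chartMap F x) (range (𝓡∂ n)) (extChartAt (𝓡∂ n) x x) v =
      mfderiv (𝓡∂ n) (cylModel n) F x v :=
  congr($((hF.mdifferentiableAt (x := x) (by simp)).mfderiv) v).symm

variable [IsManifold (𝓡∂ n) ∞ M]

theorem coordField_self {S : Type*} {F : S → M × ℝ}
    {N : ∀ x : S, TangentSpace (cylModel n) (F x)} (x : S) : coordField F N x x = N x :=
  congr($(mfderiv_extChartAt_self (I := cylModel n) (x := F x)) (N x))

theorem fderivWithin_chartMap [IsManifold (𝓡∂ n) ∞ S] {F : S → M × ℝ}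
    (hF : ContMDiff (𝓡∂ n) (cylModel n) ∞ F)
    {x : S} {z : EuclideanSpace ℝ (Fin n)} (hz : z ∈ chartDomain F x)
    (v : EuclideanSpace ℝ (Fin n)) :
    fderivWithin ℝ (chartMap F x) (range (𝓡∂ n)) z v =
      mfderiv (cylModel n) 𝓘(ℝ, EuclideanSpace ℝ (Fin n) × ℝ) (extChartAt (cylModel n) (F x))
        (F ((extChartAt (𝓡∂ n) x).symm z))
        (mfderiv (𝓡∂ n) (cylModel n) F ((extChartAt (𝓡∂ n) x).symm z)
          (mfderivWithin 𝓘(ℝ, EuclideanSpace ℝ (Fin n)) (𝓡∂ n) (extChartAt (𝓡∂ n) x).symm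
            (range (𝓡∂ n)) z v)) := by
  have hu : UniqueMDiffWithinAt 𝓘(ℝ, EuclideanSpace ℝ (Fin n)) (range (𝓡∂ n)) z :=
    (𝓡∂ n).uniqueMDiffOn _ (extChartAt_target_subset_range _ hz.1)
  have h0 := mdifferentiableWithinAt_extChartAt_symm (I := 𝓡∂ n) hz.1
  have h1 : MDifferentiableAt (𝓡∂ n) (cylModel n) F ((extChartAt (𝓡∂ n) x).symm z) :=
    hF.mdifferentiableAt (by simp)
  have h2 : MDifferentiableAt (cylModel n) 𝓘(ℝ, EuclideanSpace ℝ (Fin n) × ℝ)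
      (extChartAt (cylModel n) (F x)) (F ((extChartAt (𝓡∂ n) x).symm z)) :=
    mdifferentiableAt_extChartAt (by rw [← extChartAt_source (cylModel n)]; exact hz.2)
  have h3 := mfderiv_comp_mfderivWithin z (h2.comp _ h1) h0 hu
  rw [mfderiv_comp _ h2 h1] at h3
  have h4 : mfderivWithin 𝓘(ℝ, EuclideanSpace ℝ (Fin n)) 𝓘(ℝ, EuclideanSpace ℝ (Fin n) × ℝ)
    (chartMap F x) (range (𝓡∂ n)) z = fderivWithin ℝ (chartMap F x) (range (𝓡∂ n)) z :=
    mfderivWithin_eq_fderivWithin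
  exact (congr($h4 v)).symm.trans congr($h3 v)

variable [RiemannianBundle (fun x : M => TangentSpace (𝓡∂ n) x)]
  [RiemannianBundle (fun x : S => TangentSpace (𝓡∂ n) x)]
  {F : S → M × ℝ} {N : ∀ x : S, TangentSpace (cylModel n) (F x)}

theorem mdifferentiableAt_coordField (hF : IsTwoSidedHypersurface F N) (x : S) :
    MDifferentiableAt (𝓡∂ n) 𝓘(ℝ, EuclideanSpace ℝ (Fin n) × ℝ) (coordField F N x) x := by
  have h := (contMDiffAt_totalSpace.1 (hF.smooth_normal x)).2
  refine MDifferentiableAt.congr_of_eventuallyEq (h.mdifferentiableAt (by simp)) ?_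
  have : F ⁻¹' (chartAt (ModelProd (EuclideanHalfSpace n) ℝ) (F x)).source ∈ 𝓝 x :=
    hF.smooth.continuous.continuousAt.preimage_mem_nhds (chart_source_mem_nhds _ _)
  filter_upwards [this] with z hz
  exact (trivializationAt_tangent_snd hz (N z)).symm

variable [IsManifold (𝓡∂ n) ∞ S]

/-- The induced metric in coordinates. -/
theorem coordMetric_eq_of_isometric (hF : IsTwoSidedHypersurface F N) {x : S}
    {z : EuclideanSpace ℝ (Fin n)} (hz : z ∈ chartDomain F x) (v w : EuclideanSpace ℝ (Fin n)) :
    coordMetric (metricTensor (𝓡∂ n)) x v w z =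
      coordMetric cylMetric (F x) (fderivWithin ℝ (chartMap F x) (range (𝓡∂ n)) z v)
        (fderivWithin ℝ (chartMap F x) (range (𝓡∂ n)) z w) (chartMap F x z) := by
  rw [fderivWithin_chartMap hF.smooth hz, fderivWithin_chartMap hF.smooth hz]
  refine Eq.trans ?_ (coordMetric_mfderiv cylMetric hz.2 _ _).symm
  exact (hF.isometric _ _ _).symm

theorem coordMetric_normal (hF : IsTwoSidedHypersurface F N) {x : S}
    {z : EuclideanSpace ℝ (Fin n)} (hz : z ∈ chartDomain F x) (w : EuclideanSpace ℝ (Fin n)) :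
    coordMetric cylMetric (F x) (coordField F N x ((extChartAt (𝓡∂ n) x).symm z))
        (fderivWithin ℝ (chartMap F x) (range (𝓡∂ n)) z w) (chartMap F x z) = 0 := by
  rw [fderivWithin_chartMap hF.smooth hz]
  refine Eq.trans (coordMetric_mfderiv cylMetric hz.2 _ _) ?_
  exact hF.normal _ _

end Hypersurface

section SecondDerivatives

variable {n : ℕ} [NeZero n]
  {M : Type*} [TopologicalSpace M] [ChartedSpace (EuclideanHalfSpace n) M]
  {S : Type*} [TopologicalSpace S] [ChartedSpace (EuclideanHalfSpace n) S]

/-- The second derivative of the expression of `F` in the preferred charts. -/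
noncomputable def chartSndDeriv (F : S → M × ℝ) (x : S) (u v : EuclideanSpace ℝ (Fin n)) :
    EuclideanSpace ℝ (Fin n) × ℝ :=
  fderivWithin ℝ (fun z => fderivWithin ℝ (chartMap F x) (range (𝓡∂ n)) z v) (range (𝓡∂ n))
    (extChartAt (𝓡∂ n) x x) u

theorem differentiableWithinAt_fderivWithin_of_contDiffWithinAt {E W : Type*}
    [NormedAddCommGroup E] [NormedSpace ℝ E] [NormedAddCommGroup W] [NormedSpace ℝ W] {f : E → W}
    {R : Set E} {z : E} (hR : UniqueDiffOn ℝ R) (hz : z ∈ R) (hf : ContDiffWithinAt ℝ ∞ f R z) :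
    DifferentiableWithinAt ℝ (fderivWithin ℝ f R) R z :=
  (hf.fderivWithin_right (m := 1) hR (by rw [one_add_one_eq_two]; exact ENat.LEInfty.out) hz).differentiableWithinAt
    one_ne_zero

theorem fderivWithin_fderivWithin_apply {E W : Type*}
    [NormedAddCommGroup E] [NormedSpace ℝ E] [NormedAddCommGroup W] [NormedSpace ℝ W] {f : E → W}
    {R : Set E} {z : E} (hR : UniqueDiffOn ℝ R) (hz : z ∈ R) (hf : ContDiffWithinAt ℝ ∞ f R z)
    (u v : E) :
    fderivWithin ℝ (fun y => fderivWithin ℝ f R y v) R z u =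
      fderivWithin ℝ (fderivWithin ℝ f R) R z u v := by
  have h := differentiableWithinAt_fderivWithin_of_contDiffWithinAt hR hz hf
  rw [fderivWithin_clm_apply (hR z hz) h (differentiableWithinAt_const v)]
  simp

variable {F : S → M × ℝ}

theorem chartSndDeriv_symm (hF : ContMDiff (𝓡∂ n) (cylModel n) ∞ F) (x : S)
    (u v : EuclideanSpace ℝ (Fin n)) : chartSndDeriv F x u v = chartSndDeriv F x v u := by
  have hc := contDiffWithinAt_chartMap hF x
  have hz : extChartAt (𝓡∂ n) x x ∈ range (𝓡∂ n) := mem_range_self _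
  rw [chartSndDeriv, chartSndDeriv, fderivWithin_fderivWithin_apply (𝓡∂ n).uniqueDiffOn hz hc,
    fderivWithin_fderivWithin_apply (𝓡∂ n).uniqueDiffOn hz hc]
  refine hc.isSymmSndFDerivWithinAt (by simpa using ENat.LEInfty.out) (𝓡∂ n).uniqueDiffOn ?_ hz u v
  exact (𝓡∂ n).range_subset_closure_interior hz

/-- The height function of a map to `M × ℝ`, in coordinates. -/
theorem height_comp_extChartAt_symm (F : S → M × ℝ) (x : S) (z : EuclideanSpace ℝ (Fin n)) :
    ((fun p => (F p).2) ∘ (extChartAt (𝓡∂ n) x).symm) z = (chartMap F x z).2 := by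
  simp only [chartMap, Function.comp, extChartAt_prod, extChartAt_model_space_eq_id]
  rfl

theorem fderivWithin_height (hF : ContMDiff (𝓡∂ n) (cylModel n) ∞ F) (x : S)
    (v w : EuclideanSpace ℝ (Fin n)) :
    fderivWithin ℝ (fderivWithin ℝ ((fun p => (F p).2) ∘ (extChartAt (𝓡∂ n) x).symm)
      (range (𝓡∂ n))) (range (𝓡∂ n)) (extChartAt (𝓡∂ n) x x) v w = (chartSndDeriv F x v w).2 := by
  have hc := contDiffWithinAt_chartMap hF x
  have hz : extChartAt (𝓡∂ n) x x ∈ range (𝓡∂ n) := mem_range_self _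
  have hu := (𝓡∂ n).uniqueDiffOn
  rw [show ((fun p => (F p).2) ∘ (extChartAt (𝓡∂ n) x).symm) = fun z => (chartMap F x z).2 from
    funext (height_comp_extChartAt_symm F x),
    ← fderivWithin_fderivWithin_apply hu hz hc.snd, chartSndDeriv]
  have hd := differentiableWithinAt_fderivWithin_of_contDiffWithinAt hu hz hc
  have hd' : DifferentiableWithinAt ℝ
      (fun z => fderivWithin ℝ (chartMap F x) (range (𝓡∂ n)) z w) (range (𝓡∂ n))
      (extChartAt (𝓡∂ n) x x) := hd.clm_apply (differentiableWithinAt_const w)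
  have hev : (fun z => fderivWithin ℝ (fun z => (chartMap F x z).2) (range (𝓡∂ n)) z w)
      =ᶠ[𝓝[range (𝓡∂ n)] (extChartAt (𝓡∂ n) x x)]
      fun z => (fderivWithin ℝ (chartMap F x) (range (𝓡∂ n)) z w).2 := by
    have h1 := (hc.of_le (m := 1) (by exact_mod_cast le_top)).eventually (by simp)
    rw [insert_eq_of_mem hz] at h1
    filter_upwards [h1, self_mem_nhdsWithin] with z hz1 hz2
    rw [fderivWithin.snd (hu z hz2) (hz1.differentiableWithinAt one_ne_zero)]
    rfl
  rw [hev.fderivWithin_eq_of_mem hz, fderivWithin.snd (hu _ hz) hd']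
  rfl

theorem eventually_chartMap_mem_range (hF : Continuous F) (x : S) :
    ∀ᶠ z in 𝓝[range (𝓡∂ n)] (extChartAt (𝓡∂ n) x x), chartMap F x z ∈ range (cylModel n) := by
  filter_upwards [chartDomain_mem_nhdsWithin hF x] with z hz
  exact extChartAt_target_subset_range _ ((extChartAt (cylModel n) (F x)).map_source hz.2)

theorem differentiableWithinAt_fderivWithin_chartMap (hF : ContMDiff (𝓡∂ n) (cylModel n) ∞ F)
    (x : S) (v : EuclideanSpace ℝ (Fin n)) : DifferentiableWithinAt ℝ
      (fun z => fderivWithin ℝ (chartMap F x) (range (𝓡∂ n)) z v) (range (𝓡∂ n))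
      (extChartAt (𝓡∂ n) x x) :=
  (differentiableWithinAt_fderivWithin_of_contDiffWithinAt (𝓡∂ n).uniqueDiffOn (mem_range_self _)
    (contDiffWithinAt_chartMap hF x)).clm_apply (differentiableWithinAt_const v)

variable [IsManifold (𝓡∂ n) ∞ M] [RiemannianBundle (fun x : M => TangentSpace (𝓡∂ n) x)]
  [IsContMDiffRiemannianBundle (𝓡∂ n) ∞ (EuclideanSpace ℝ (Fin n))
    (fun x : M => TangentSpace (𝓡∂ n) x)]

/-- The product rule for the metric of `M × ℝ` along `F`, in coordinates. -/
theorem fderivWithin_coordMetric_chartMap (hF : ContMDiff (𝓡∂ n) (cylModel n) ∞ F) (x : S)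
    {A B : EuclideanSpace ℝ (Fin n) → EuclideanSpace ℝ (Fin n) × ℝ}
    (hA : DifferentiableWithinAt ℝ A (range (𝓡∂ n)) (extChartAt (𝓡∂ n) x x))
    (hB : DifferentiableWithinAt ℝ B (range (𝓡∂ n)) (extChartAt (𝓡∂ n) x x))
    (u : EuclideanSpace ℝ (Fin n)) :
    fderivWithin ℝ (fun z => coordMetric cylMetric (F x) (A z) (B z) (chartMap F x z))
        (range (𝓡∂ n)) (extChartAt (𝓡∂ n) x x) u =
      dMetric cylMetric (F x) (mfderiv (𝓡∂ n) (cylModel n) F x u)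
          (A (extChartAt (𝓡∂ n) x x)) (B (extChartAt (𝓡∂ n) x x))
        + cylMetric (F x) (fderivWithin ℝ A (range (𝓡∂ n)) (extChartAt (𝓡∂ n) x x) u)
            (B (extChartAt (𝓡∂ n) x x))
        + cylMetric (F x) (A (extChartAt (𝓡∂ n) x x))
            (fderivWithin ℝ B (range (𝓡∂ n)) (extChartAt (𝓡∂ n) x x) u) := by
  have hz : extChartAt (𝓡∂ n) x x ∈ range (𝓡∂ n) := mem_range_self _
  have hc := contDiffWithinAt_chartMap hF x
  rw [fderivWithin_bilinear_family (R' := range (cylModel n))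
    (coordMetric_cyl_bilinear (F x)) ((𝓡∂ n).uniqueDiffOn _ hz)
    (by rw [chartMap_self]; exact (cylModel n).uniqueDiffOn _ (mem_range_self _))
    (fun v w => by
      rw [chartMap_self]; exact (hasFDerivWithinAt_coordMetric_cyl (F x) v w).differentiableWithinAt)
    (hc.differentiableWithinAt (by simp)) hA hB (eventually_chartMap_mem_range hF.continuous x)]
  rw [chartMap_self]
  refine congrArg₂ (· + ·) (congrArg₂ (· + ·) ?_ (coordMetric_self cylMetric (F x) _ _))
    (coordMetric_self cylMetric (F x) _ _)
  exact congrArg (fderivWithin ℝ (coordMetric cylMetric (F x) _ _) (range (cylModel n)) _)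
    (fderivWithin_chartMap_self hF x u)

variable [IsManifold (𝓡∂ n) ∞ S] [RiemannianBundle (fun x : S => TangentSpace (𝓡∂ n) x)]
  {N : ∀ x : S, TangentSpace (cylModel n) (F x)}

/-- The derivative of the induced metric. -/
theorem dMetric_eq (hF : IsTwoSidedHypersurface F N) (x : S) (u v w : TangentSpace (𝓡∂ n) x) :
    dMetric (metricTensor (𝓡∂ n)) x u v w =
      dMetric cylMetric (F x) (mfderiv (𝓡∂ n) (cylModel n) F x u)
          (mfderiv (𝓡∂ n) (cylModel n) F x v) (mfderiv (𝓡∂ n) (cylModel n) F x w)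
        + cylMetric (F x) (chartSndDeriv F x u v) (mfderiv (𝓡∂ n) (cylModel n) F x w)
        + cylMetric (F x) (mfderiv (𝓡∂ n) (cylModel n) F x v) (chartSndDeriv F x u w) := by
  have hz : extChartAt (𝓡∂ n) x x ∈ range (𝓡∂ n) := mem_range_self _
  have hev : coordMetric (metricTensor (𝓡∂ n)) x v w
      =ᶠ[𝓝[range (𝓡∂ n)] (extChartAt (𝓡∂ n) x x)]
      fun z => coordMetric cylMetric (F x) (fderivWithin ℝ (chartMap F x) (range (𝓡∂ n)) z v)
        (fderivWithin ℝ (chartMap F x) (range (𝓡∂ n)) z w) (chartMap F x z) := by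
    filter_upwards [chartDomain_mem_nhdsWithin hF.smooth.continuous x] with z hz
    exact coordMetric_eq_of_isometric hF hz v w
  refine congr($(hev.fderivWithin_eq_of_mem hz) u).trans ?_
  refine (fderivWithin_coordMetric_chartMap hF.smooth x
    (differentiableWithinAt_fderivWithin_chartMap hF.smooth x v)
    (differentiableWithinAt_fderivWithin_chartMap hF.smooth x w) u).trans ?_
  beta_reduce
  rw [fderivWithin_chartMap_self hF.smooth x v, fderivWithin_chartMap_self hF.smooth x w]
  rfl

/-- The derivative of the orthogonality relation between the Gauss map and the tangent spaces. -/
theorem dMetric_normal (hF : IsTwoSidedHypersurface F N) (x : S) (v w : TangentSpace (𝓡∂ n) x) :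
    dMetric cylMetric (F x) (mfderiv (𝓡∂ n) (cylModel n) F x v) (N x)
          (mfderiv (𝓡∂ n) (cylModel n) F x w)
        + cylMetric (F x)
          (mfderiv (𝓡∂ n) 𝓘(ℝ, EuclideanSpace ℝ (Fin n) × ℝ) (coordField F N x) x v)
          (mfderiv (𝓡∂ n) (cylModel n) F x w)
        + cylMetric (F x) (N x) (chartSndDeriv F x v w) = 0 := by
  have hz : extChartAt (𝓡∂ n) x x ∈ range (𝓡∂ n) := mem_range_self _
  have hev : (fun z => coordMetric cylMetric (F x)
        (coordField F N x ((extChartAt (𝓡∂ n) x).symm z))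
        (fderivWithin ℝ (chartMap F x) (range (𝓡∂ n)) z w) (chartMap F x z))
      =ᶠ[𝓝[range (𝓡∂ n)] (extChartAt (𝓡∂ n) x x)] fun _ => 0 := by
    filter_upwards [chartDomain_mem_nhdsWithin hF.smooth.continuous x] with z hz
    exact coordMetric_normal hF hz w
  have hN := mdifferentiableAt_coordField hF x
  have hN' : DifferentiableWithinAt ℝ (fun z => coordField F N x ((extChartAt (𝓡∂ n) x).symm z))
      (range (𝓡∂ n)) (extChartAt (𝓡∂ n) x x) := hN.differentiableWithinAt_writtenInExtChartAt
  have h1 := fderivWithin_coordMetric_chartMap hF.smooth x hN'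
    (differentiableWithinAt_fderivWithin_chartMap hF.smooth x w) v
  rw [hev.fderivWithin_eq_of_mem hz, fderivWithin_fun_const] at h1
  rw [extChartAt_to_inv, coordField_self] at h1
  have h2 : mfderiv (𝓡∂ n) 𝓘(ℝ, EuclideanSpace ℝ (Fin n) × ℝ) (coordField F N x) x =
    fderivWithin ℝ (fun z => coordField F N x ((extChartAt (𝓡∂ n) x).symm z))
      (range (𝓡∂ n)) (extChartAt (𝓡∂ n) x x) := hN.mfderiv
  rw [fderivWithin_chartMap_self hF.smooth x w] at h1
  rw [h2]
  exact h1.symm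

end SecondDerivatives

section CylinderAlgebra

variable {n : ℕ} [NeZero n]
  {M : Type*} [TopologicalSpace M] [ChartedSpace (EuclideanHalfSpace n) M]
  [RiemannianBundle (fun x : M => TangentSpace (𝓡∂ n) x)]

theorem cylMetric_comm (y : M × ℝ) (v w : TangentSpace (cylModel n) y) :
    cylMetric y v w = cylMetric y w v := by
  rw [cylMetric, cylMetric, real_inner_comm, mul_comm]

theorem cylMetric_sub_smul_right (y : M × ℝ) (u v w : TangentSpace (cylModel n) y) (c : ℝ) :
    cylMetric y u (v - c • w) = cylMetric y u v - c * cylMetric y u w := by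
  obtain ⟨B, hB⟩ := exists_bilinear_cylMetric (n := n) y
  simp [← hB]

theorem cylMetric_add_smul_right (y : M × ℝ) (u v w : TangentSpace (cylModel n) y) (c : ℝ) :
    cylMetric y u (v + c • w) = cylMetric y u v + c * cylMetric y u w := by
  obtain ⟨B, hB⟩ := exists_bilinear_cylMetric (n := n) y
  simp [← hB]

theorem cylMetric_xi_right (y : M × ℝ) (v : TangentSpace (cylModel n) y) :
    cylMetric y v (xi y) = vert y v := by
  have h1 : horiz (n := n) y (xi y) = 0 := rfl
  have h2 : vert (n := n) y (xi y) = 1 := rfl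
  rw [cylMetric, h1, h2, inner_zero_right]
  ring

theorem cylMetric_zero_right (y : M × ℝ) (v : TangentSpace (cylModel n) y) :
    cylMetric y v 0 = 0 := by
  obtain ⟨B, hB⟩ := exists_bilinear_cylMetric (n := n) y
  simp [← hB]

theorem dMetric_cyl_comm (y : M × ℝ) (U V W : EuclideanSpace ℝ (Fin n) × ℝ) :
    dMetric cylMetric y U V W = dMetric cylMetric y U W V := by
  have : coordMetric cylMetric y V W = coordMetric cylMetric y W V :=
    funext fun z => cylMetric_comm _ _ _
  rw [dMetric, dMetric, this]

/-- The compatibility of the Levi-Civita connection with the metric. -/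
theorem christoffel_cyl_add (y : M × ℝ) (U V W : EuclideanSpace ℝ (Fin n) × ℝ) :
    christoffel cylMetric y U V W + christoffel cylMetric y U W V = dMetric cylMetric y U V W := by
  rw [christoffel, christoffel, dMetric_cyl_comm y W U V, dMetric_cyl_comm y V U W,
    dMetric_cyl_comm y U W V]
  ring

variable [IsManifold (𝓡∂ n) ∞ M]
  [IsContMDiffRiemannianBundle (𝓡∂ n) ∞ (EuclideanSpace ℝ (Fin n))
    (fun x : M => TangentSpace (𝓡∂ n) x)]

theorem dMetric_cyl_sub_smul (y : M × ℝ) (U V W W' : EuclideanSpace ℝ (Fin n) × ℝ) (c : ℝ) :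
    dMetric cylMetric y U V (W - c • W') =
      dMetric cylMetric y U V W - c * dMetric cylMetric y U V W' := by
  have h : coordMetric cylMetric y V (W - c • W') =
      coordMetric cylMetric y V W - c • coordMetric cylMetric y V W' := by
    funext z
    obtain ⟨B, hB⟩ := coordMetric_cyl_bilinear y z
    simp [← hB]
  have hu : UniqueDiffWithinAt ℝ (range (cylModel n)) (extChartAt (cylModel n) y y) :=
    (cylModel n).uniqueDiffOn _ (mem_range_self _)
  rw [dMetric, h, ((hasFDerivWithinAt_coordMetric_cyl y V W).sub
    ((hasFDerivWithinAt_coordMetric_cyl y V W').const_smul c)).fderivWithin hu]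
  rw [dMetric_cyl, dMetric_cyl]
  rfl

theorem christoffel_cyl_sub_smul (y : M × ℝ) (U V W W' : EuclideanSpace ℝ (Fin n) × ℝ) (c : ℝ) :
    christoffel cylMetric y U V (W - c • W') =
      christoffel cylMetric y U V W - c * christoffel cylMetric y U V W' := by
  have h : dMetric cylMetric y (W - c • W') U V =
      dMetric cylMetric y W U V - c * dMetric cylMetric y W' U V := by
    simp [dMetric]
  rw [christoffel, christoffel, christoffel, dMetric_cyl_sub_smul, dMetric_cyl_sub_smul, h]
  ring

end CylinderAlgebra

section Gradient

variable {E : Type*} [NormedAddCommGroup E] [NormedSpace ℝ E] [FiniteDimensional ℝ E]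
  {H : Type*} [TopologicalSpace H] {I : ModelWithCorners ℝ E H}
  {S : Type*} [TopologicalSpace S] [ChartedSpace H S]
  [RiemannianBundle (fun x : S => TangentSpace I x)]

theorem inner_grad (u : S → ℝ) (x : S) (v : TangentSpace I x) :
    inner ℝ (grad I u x) v = differential I u x v := by
  let L : TangentSpace I x →ₗ[ℝ] ℝ := (mfderiv I 𝓘(ℝ, ℝ) u x).toLinearMap
  have hL : ∀ w, differential I u x w = L w := fun _ => rfl
  let b := stdOrthonormalBasis ℝ (TangentSpace I x)
  have h1 : grad I u x = ∑ i, L (b i) • b i := rfl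
  rw [h1, hL]
  conv_rhs => rw [← b.sum_repr' v, map_sum]
  rw [sum_inner]
  refine Finset.sum_congr rfl fun i _ => ?_
  rw [real_inner_smul_left, map_smul, smul_eq_mul, mul_comm]

end Gradient

section Height

variable {n : ℕ} [NeZero n]
  {M : Type*} [TopologicalSpace M] [ChartedSpace (EuclideanHalfSpace n) M]
  {S : Type*} [TopologicalSpace S] [ChartedSpace (EuclideanHalfSpace n) S]
  {F : S → M × ℝ}

theorem differential_height (hF : ContMDiff (𝓡∂ n) (cylModel n) ∞ F) (x : S)
    (v : TangentSpace (𝓡∂ n) x) :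
    differential (𝓡∂ n) (fun p => (F p).2) x v =
      vert (F x) (mfderiv (𝓡∂ n) (cylModel n) F x v) := by
  have h1 : MDifferentiableAt (𝓡∂ n) (cylModel n) F x := hF.mdifferentiableAt (by simp)
  have h2 := mfderiv_comp x (mdifferentiableAt_snd (I := 𝓡∂ n) (I' := 𝓘(ℝ, ℝ)) (x := F x)) h1
  rw [mfderiv_snd] at h2
  exact congr($h2 v)

variable [RiemannianBundle (fun x : M => TangentSpace (𝓡∂ n) x)] [IsManifold (𝓡∂ n) ∞ M]
  [RiemannianBundle (fun x : S => TangentSpace (𝓡∂ n) x)]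
  {N : ∀ x : S, TangentSpace (cylModel n) (F x)}

/-- The tangent space of `M × ℝ` is spanned by the tangent space of the hypersurface and the
normal. -/
theorem exists_tangent_add_normal (hF : IsTwoSidedHypersurface F N) (x : S)
    (w : TangentSpace (cylModel n) (F x)) :
    ∃ (v : TangentSpace (𝓡∂ n) x) (t : ℝ),
      mfderiv (𝓡∂ n) (cylModel n) F x v + t • N x = w := by
  let L : TangentSpace (𝓡∂ n) x × ℝ →ₗ[ℝ] TangentSpace (cylModel n) (F x) :=
    (mfderiv (𝓡∂ n) (cylModel n) F x).toLinearMap.coprod (LinearMap.toSpanSingleton ℝ _ (N x))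
  have hL : ∀ p, L p = mfderiv (𝓡∂ n) (cylModel n) F x p.1 + p.2 • N x := fun _ => rfl
  have hinj : Function.Injective L := by
    refine (injective_iff_map_eq_zero _).2 fun p hp => ?_
    have h1 : p.2 = 0 := by
      have := cylMetric_zero_right (F x) (N x)
      rw [← hp, hL, cylMetric_add_smul_right, hF.normal, hF.unit] at this
      linarith
    have h2 : mfderiv (𝓡∂ n) (cylModel n) F x p.1 = 0 := by
      rw [hL, h1, zero_smul, add_zero] at hp
      exact hp
    have h3 := hF.isometric x p.1 p.1
    rw [h2, cylMetric_zero_right] at h3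
    exact Prod.ext (inner_self_eq_zero.1 h3.symm) h1
  have hfr : Module.finrank ℝ (TangentSpace (𝓡∂ n) x × ℝ) =
      Module.finrank ℝ (TangentSpace (cylModel n) (F x)) :=
    show Module.finrank ℝ (EuclideanSpace ℝ (Fin n) × ℝ) =
      Module.finrank ℝ (EuclideanSpace ℝ (Fin n) × ℝ) from rfl
  have hfd : FiniteDimensional ℝ (TangentSpace (cylModel n) (F x)) :=
    inferInstanceAs (FiniteDimensional ℝ (EuclideanSpace ℝ (Fin n) × ℝ))
  obtain ⟨p, hp⟩ := (LinearMap.injective_iff_surjective_of_finrank_eq_finrank hfr).1 hinj w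
  exact ⟨p.1, p.2, hp⟩

/-- The gradient of the height function is the tangential part of `ξ`. -/
theorem mfderiv_grad_height (hF : IsTwoSidedHypersurface F N) (x : S) :
    mfderiv (𝓡∂ n) (cylModel n) F x (grad (𝓡∂ n) (fun p => (F p).2) x) =
      xi (F x) - angle F N x • N x := by
  obtain ⟨k, t, hk⟩ := exists_tangent_add_normal hF x (xi (F x))
  have ht : angle F N x = t := by
    rw [angle, cylMetric_comm, ← hk, cylMetric_add_smul_right, hF.normal, hF.unit]
    ring
  have hgrad : grad (𝓡∂ n) (fun p => (F p).2) x = k := by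
    refine ext_inner_right ℝ fun v => ?_
    rw [inner_grad, differential_height hF.smooth, ← cylMetric_xi_right, ← hk,
      cylMetric_add_smul_right, cylMetric_comm _ _ (N x), hF.normal, cylMetric_comm, hF.isometric]
    ring
  rw [hgrad, ht, ← hk, add_sub_cancel_right]

variable [IsManifold (𝓡∂ n) ∞ S]
  [IsContMDiffRiemannianBundle (𝓡∂ n) ∞ (EuclideanSpace ℝ (Fin n))
    (fun x : M => TangentSpace (𝓡∂ n) x)]

/-- The Gauss formula for the Hessian of the height function. -/
theorem hessian_height (hF : IsTwoSidedHypersurface F N) (x : S) (v w : TangentSpace (𝓡∂ n) x) :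
    hessian (𝓡∂ n) (fun p => (F p).2) x v w =
      -angle F N x * covDerivInner F N x v (mfderiv (𝓡∂ n) (cylModel n) F x w) := by
  set k := grad (𝓡∂ n) (fun p => (F p).2) x with hk
  set D := mfderiv (𝓡∂ n) (cylModel n) F x with hD
  have hDk : D k = xi (F x) - angle F N x • N x := mfderiv_grad_height hF x
  have h1 : hessian (𝓡∂ n) (fun p => (F p).2) x v w =
      (chartSndDeriv F x v w).2 - christoffel (metricTensor (𝓡∂ n)) x v w k := by
    rw [← fderivWithin_height hF.smooth x v w]
    rfl
  have h2 : christoffel (metricTensor (𝓡∂ n)) x v w k =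
      christoffel cylMetric (F x) (D v) (D w) (D k)
        + cylMetric (F x) (chartSndDeriv F x v w) (D k) := by
    have e1 := dMetric_eq hF x v w k
    have e2 := dMetric_eq hF x w v k
    have e3 := dMetric_eq hF x k v w
    have s1 : cylMetric (F x) (chartSndDeriv F x w v) (D k) =
        cylMetric (F x) (chartSndDeriv F x v w) (D k) :=
      congrArg (fun q : EuclideanSpace ℝ (Fin n) × ℝ => cylMetric (F x) q (D k))
        (chartSndDeriv_symm hF.smooth x w v)
    have s2 : cylMetric (F x) (chartSndDeriv F x k v) (D w) =
        cylMetric (F x) (D w) (chartSndDeriv F x v k) :=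
      (congrArg (fun q : EuclideanSpace ℝ (Fin n) × ℝ => cylMetric (F x) q (D w))
        (chartSndDeriv_symm hF.smooth x k v)).trans (cylMetric_comm _ _ _)
    have s3 : cylMetric (F x) (D v) (chartSndDeriv F x k w) =
        cylMetric (F x) (D v) (chartSndDeriv F x w k) :=
      congrArg (fun q : EuclideanSpace ℝ (Fin n) × ℝ => cylMetric (F x) (D v) q)
        (chartSndDeriv_symm hF.smooth x k w)
    unfold christoffel
    linarith
  have h3 : cylMetric (F x) (chartSndDeriv F x v w) (D k) =
      (chartSndDeriv F x v w).2 - angle F N x * cylMetric (F x) (N x) (chartSndDeriv F x v w) := by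
    have q : ∀ q : TangentSpace (cylModel n) (F x), cylMetric (F x) q (D k) =
        vert (F x) q - angle F N x * cylMetric (F x) (N x) q := fun q => by
      rw [hDk, cylMetric_sub_smul_right, cylMetric_xi_right, cylMetric_comm _ _ (N x)]
    exact q _
  have h4 : christoffel cylMetric (F x) (D v) (D w) (D k) =
      - (angle F N x * christoffel cylMetric (F x) (D v) (D w) (N x)) := by
    rw [hDk]
    refine (christoffel_cyl_sub_smul (F x) (D v) (D w) (xi (F x)) (N x) (angle F N x)).trans ?_
    rw [show christoffel cylMetric (F x) (D v) (D w) (xi (F x)) = 0 from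
      (christoffel_cyl_xi (F x) (D v) (D w) 1).1]
    ring
  have h5 := dMetric_normal hF x v w
  have h6 := christoffel_cyl_add (F x) (D v) (D w) (N x)
  have h7 := dMetric_cyl_comm (F x) (D v) (D w) (N x)
  have h8 : covDerivInner F N x v (D w) =
      -cylMetric (F x) (N x) (chartSndDeriv F x v w)
        - christoffel cylMetric (F x) (D v) (D w) (N x) := by
    unfold covDerivInner
    linarith
  rw [h1, h2, h3, h4, h8]
  ring

end Height

section DriftedLaplacian

variable {n : ℕ} [NeZero n]
  {M : Type*} [TopologicalSpace M] [ChartedSpace (EuclideanHalfSpace n) M]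

theorem contMDiff_productWeight {h : M → ℝ} (hh : ContMDiff (𝓡∂ n) 𝓘(ℝ, ℝ) ∞ h) {v : ℝ → ℝ}
    (hv : ContDiff ℝ ∞ v) : ContMDiff (cylModel n) 𝓘(ℝ, ℝ) ∞ (productWeight h v) :=
  (hh.comp contMDiff_fst).add (hv.contMDiff.comp contMDiff_snd)

theorem differential_productWeight_xi {h : M → ℝ} (hh : ContMDiff (𝓡∂ n) 𝓘(ℝ, ℝ) ∞ h) {v : ℝ → ℝ}
    (hv : ContDiff ℝ ∞ v) (y : M × ℝ) :
    differential (cylModel n) (productWeight h v) y (xi y) = deriv v y.2 := by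
  have h1 : MDifferentiableAt (cylModel n) 𝓘(ℝ, ℝ) (productWeight h v) y :=
    (contMDiff_productWeight hh hv).mdifferentiableAt (by simp)
  have h2 : MDifferentiableAt 𝓘(ℝ, ℝ) (cylModel n) (fun t : ℝ => (y.1, t)) y.2 :=
    (contMDiff_const.prodMk contMDiff_id : ContMDiff 𝓘(ℝ, ℝ) (cylModel n) 1 _).mdifferentiableAt
      one_ne_zero
  have h3 := mfderiv_comp y.2 (g := productWeight h v) (f := fun t : ℝ => (y.1, t)) h1 h2
  rw [mfderiv_prod_right] at h3
  have h4 : mfderiv 𝓘(ℝ, ℝ) 𝓘(ℝ, ℝ) (productWeight h v ∘ fun t : ℝ => (y.1, t)) y.2 =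
      fderiv ℝ (fun t : ℝ => h y.1 + v t) y.2 := mfderiv_eq_fderiv
  have h5 : fderiv ℝ (fun t : ℝ => h y.1 + v t) y.2 1 = deriv v y.2 := by
    rw [fderiv_const_add]; rfl
  exact (congr($h3 (1 : ℝ))).symm.trans ((congr($h4 (1 : ℝ))).trans h5)

variable [IsManifold (𝓡∂ n) ∞ M]

theorem coordField_sliceNormal {s : ℝ} {p z : M} (hz : z ∈ (extChartAt (𝓡∂ n) p).source) :
    coordField (slice s) (sliceNormal (n := n) s) p z = (0, -1) := by
  have hy : slice s z ∈ (extChartAt (cylModel n) (slice s p)).source := by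
    rw [extChartAt_source] at hz ⊢
    exact ⟨hz, mem_univ _⟩
  have h1 := mfderivWithin_cyl_symm ((extChartAt (cylModel n) (slice s p)).map_source hy)
    ((0, -1) : EuclideanSpace ℝ (Fin n) × ℝ)
  have h2 : (mfderivWithin 𝓘(ℝ, EuclideanSpace ℝ (Fin n) × ℝ) (cylModel n)
        (extChartAt (cylModel n) (slice s p)).symm (range (cylModel n))
          (extChartAt (cylModel n) (slice s p) (slice s z)) (0, -1) :
            EuclideanSpace ℝ (Fin n) × ℝ) = (0, -1) :=
    h1.trans (Prod.ext (map_zero (mfderivWithin 𝓘(ℝ, EuclideanSpace ℝ (Fin n)) (𝓡∂ n)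
      (extChartAt (𝓡∂ n) p).symm (range (𝓡∂ n)) _)) rfl)
  have h3 := mfderiv_extChartAt_comp_mfderivWithin_extChartAt_symm' hy
  have h4 : (sliceNormal (n := n) s z : EuclideanSpace ℝ (Fin n) × ℝ) = (0, -1) :=
    Prod.ext neg_zero rfl
  exact (congrArg (mfderiv (cylModel n) 𝓘(ℝ, EuclideanSpace ℝ (Fin n) × ℝ)
    (extChartAt (cylModel n) (slice s p)) (slice s z)) (h4.trans h2.symm)).trans
      congr($h3 ((0, -1) : EuclideanSpace ℝ (Fin n) × ℝ))

variable [RiemannianBundle (fun x : M => TangentSpace (𝓡∂ n) x)]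
  [IsContMDiffRiemannianBundle (𝓡∂ n) ∞ (EuclideanSpace ℝ (Fin n))
    (fun x : M => TangentSpace (𝓡∂ n) x)]

/-- The weighted mean curvature of a horizontal slice. -/
theorem weightedMeanCurvature_slice {h : M → ℝ} (hh : ContMDiff (𝓡∂ n) 𝓘(ℝ, ℝ) ∞ h) {v : ℝ → ℝ}
    (hv : ContDiff ℝ ∞ v) (s : ℝ) (p : M) :
    weightedMeanCurvature (productWeight h v) (slice s) (sliceNormal (n := n) s) p =
      deriv v s := by
  have h1 : ∀ u w, covDerivInner (slice s) (sliceNormal (n := n) s) p u w = 0 := by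
    intro u w
    have hev : coordField (slice s) (sliceNormal (n := n) s) p =ᶠ[𝓝 p] fun _ => (0, -1) :=
      Filter.mem_of_superset (extChartAt_source_mem_nhds (I := 𝓡∂ n) p)
        fun z hz => coordField_sliceNormal hz
    have hc : mfderiv (𝓡∂ n) 𝓘(ℝ, EuclideanSpace ℝ (Fin n) × ℝ)
        (coordField (slice s) (sliceNormal (n := n) s) p) p = 0 :=
      hev.mfderiv_eq.trans mfderiv_const
    have hch : christoffel cylMetric (slice s p)
        (mfderiv (𝓡∂ n) (cylModel n) (slice s) p u) (sliceNormal s p) w = 0 := by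
      have h4 : (sliceNormal (n := n) s p : EuclideanSpace ℝ (Fin n) × ℝ) = (0, -1) :=
        Prod.ext neg_zero rfl
      exact (congrArg (fun X => christoffel cylMetric (slice s p)
        (mfderiv (𝓡∂ n) (cylModel n) (slice s) p u) X w) h4).trans
          (christoffel_cyl_xi (slice s p) _ _ (-1)).2
    have h0 : cylMetric (slice s p) (mfderiv (𝓡∂ n) 𝓘(ℝ, EuclideanSpace ℝ (Fin n) × ℝ)
        (coordField (slice s) (sliceNormal (n := n) s) p) p u) w = 0 := by
      refine (congrArg (fun X => cylMetric (slice s p) X w) congr($hc u)).trans ?_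
      exact (cylMetric_comm _ _ _).trans (cylMetric_zero_right _ _)
    rw [covDerivInner, hch, add_zero]
    exact h0
  have h2 : differential (cylModel n) (productWeight h v) (slice s p) (sliceNormal s p) =
      -deriv v s :=
    (map_neg (mfderiv (cylModel n) 𝓘(ℝ, ℝ) (productWeight h v) (slice s p)) _).trans
      (congrArg Neg.neg (differential_productWeight_xi hh hv (slice s p)))
  rw [weightedMeanCurvature, weightedDiv, h2]
  simp [metricTrace, h1]

variable {S : Type*} [TopologicalSpace S] [ChartedSpace (EuclideanHalfSpace n) S]
  [RiemannianBundle (fun x : S => TangentSpace (𝓡∂ n) x)] [IsManifold (𝓡∂ n) ∞ S]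
  {F : S → M × ℝ} {N : ∀ x : S, TangentSpace (cylModel n) (F x)}

/-- The drifted Laplacian of the height function. -/
theorem driftedLaplacian_height (hF : IsTwoSidedHypersurface F N) {h : M → ℝ}
    (hh : ContMDiff (𝓡∂ n) 𝓘(ℝ, ℝ) ∞ h) {v : ℝ → ℝ} (hv : ContDiff ℝ ∞ v) (x : S) :
    driftedLaplacian (𝓡∂ n) (productWeight h v ∘ F) (fun p => (F p).2) x =
      deriv v (F x).2 + angle F N x * weightedMeanCurvature (productWeight h v) F N x := by
  have h1 : metricTrace (𝓡∂ n) x (hessian (𝓡∂ n) (fun p => (F p).2) x) =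
      -angle F N x * metricTrace (𝓡∂ n) x
        (fun v w => covDerivInner F N x v (mfderiv (𝓡∂ n) (cylModel n) F x w)) := by
    rw [metricTrace, metricTrace, Finset.mul_sum]
    exact Finset.sum_congr rfl fun i _ => hessian_height hF x _ _
  have h2 : inner ℝ (grad (𝓡∂ n) (productWeight h v ∘ F) x)
      (grad (𝓡∂ n) (fun p => (F p).2) x) = deriv v (F x).2 -
        angle F N x * differential (cylModel n) (productWeight h v) (F x) (N x) := by
    rw [inner_grad, ← differential_productWeight_xi hh hv (F x)]
    have h3 : MDifferentiableAt (𝓡∂ n) (cylModel n) F x := hF.smooth.mdifferentiableAt (by simp)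
    have h4 : MDifferentiableAt (cylModel n) 𝓘(ℝ, ℝ) (productWeight h v) (F x) :=
      (contMDiff_productWeight hh hv).mdifferentiableAt (by simp)
    have h5 := mfderiv_comp x h4 h3
    have h6 := mfderiv_grad_height hF x
    let L : TangentSpace (cylModel n) (F x) →ₗ[ℝ] ℝ :=
      (mfderiv (cylModel n) 𝓘(ℝ, ℝ) (productWeight h v) (F x)).toLinearMap
    have h7 : differential (𝓡∂ n) (productWeight h v ∘ F) x
        (grad (𝓡∂ n) (fun p => (F p).2) x) = L (mfderiv (𝓡∂ n) (cylModel n) F x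
          (grad (𝓡∂ n) (fun p => (F p).2) x)) :=
      congr($h5 (grad (𝓡∂ n) (fun p => (F p).2) x))
    rw [h7, h6, map_sub, map_smul]
    rfl
  rw [driftedLaplacian, h1, h2, weightedMeanCurvature, weightedDiv]
  ring

end DriftedLaplacian

section Angle

variable {n : ℕ} [NeZero n]
  {M : Type*} [TopologicalSpace M] [ChartedSpace (EuclideanHalfSpace n) M]
  [IsManifold (𝓡∂ n) ∞ M] [RiemannianBundle (fun x : M => TangentSpace (𝓡∂ n) x)]
  {S : Type*} [TopologicalSpace S] [ChartedSpace (EuclideanHalfSpace n) S]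
  [RiemannianBundle (fun x : S => TangentSpace (𝓡∂ n) x)]
  {F : S → M × ℝ} {N : ∀ x : S, TangentSpace (cylModel n) (F x)}

theorem angle_sq_le_one (hF : IsTwoSidedHypersurface F N) (x : S) : angle F N x ^ 2 ≤ 1 := by
  have h1 : angle F N x = vert (F x) (N x) := by
    rw [angle, cylMetric_comm, cylMetric_xi_right]
  have h2 := hF.unit x
  rw [cylMetric] at h2
  have h3 : 0 ≤ inner ℝ (horiz (F x) (N x)) (horiz (F x) (N x)) := real_inner_self_nonneg
  rw [h1]
  nlinarith

end Angle

section Boundary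

variable {n : ℕ} [NeZero n]
  {M : Type*} [TopologicalSpace M] [ChartedSpace (EuclideanHalfSpace n) M]
  {S : Type*} [TopologicalSpace S] [ChartedSpace (EuclideanHalfSpace n) S]
  {F : S → M × ℝ}

theorem transverse_mfderiv_eq_zero (hF : ContMDiff (𝓡∂ n) (cylModel n) ∞ F) {x : S}
    (hx : x ∈ (𝓡∂ n).boundary S) (hFx : (F x).1 ∈ (𝓡∂ n).boundary M)
    {w : TangentSpace (𝓡∂ n) x} (hw : transverse x w = 0) :
    transverse (F x).1 (horiz (F x) (mfderiv (𝓡∂ n) (cylModel n) F x w)) = 0 := by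
  let e := extChartAt (𝓡∂ n) x x
  let w' : EuclideanSpace ℝ (Fin n) := w
  have he : e 0 = 0 := by
    have h1 : e ∈ frontier (range (𝓡∂ n)) := hx
    rw [frontier_range_modelWithCornersEuclideanHalfSpace] at h1
    exact h1.symm
  have hFe : (chartMap F x e).1 0 = 0 := by
    have h1 : extChartAt (𝓡∂ n) (F x).1 (F x).1 ∈ frontier (range (𝓡∂ n)) := hFx
    rw [frontier_range_modelWithCornersEuclideanHalfSpace] at h1
    rw [chartMap_self, extChartAt_prod]
    exact h1.symm
  have hline : ∀ t : ℝ, e + t • w' ∈ range (𝓡∂ n) := fun t => by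
    rw [range_modelWithCornersEuclideanHalfSpace, mem_ofPred_eq]
    have h1 : w' 0 = 0 := hw
    simp [he, h1]
  have hd : HasDerivAt (fun t : ℝ => e + t • w') w' 0 := by
    simpa using ((hasDerivAt_id (0 : ℝ)).smul_const w').const_add e
  have hf : HasFDerivWithinAt (chartMap F x) (fderivWithin ℝ (chartMap F x) (range (𝓡∂ n)) e)
      (range (𝓡∂ n)) (e + (0 : ℝ) • w') := by
    rw [zero_smul, add_zero]
    exact ((contDiffWithinAt_chartMap hF x).differentiableWithinAt (by simp)).hasFDerivWithinAt
  have hg := hasDerivWithinAt_univ.1 (hf.comp_hasDerivWithinAt (0 : ℝ)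
    hd.hasDerivWithinAt (s := univ) fun t _ => hline t)
  let L : EuclideanSpace ℝ (Fin n) × ℝ →L[ℝ] ℝ :=
    (EuclideanSpace.proj (0 : Fin n)).comp (ContinuousLinearMap.fst ℝ _ _)
  have hL : ∀ y, L y = y.1 0 := fun _ => rfl
  have hg' := L.hasFDerivAt.comp_hasDerivAt (0 : ℝ) hg
  have hmin : IsLocalMin (L ∘ (chartMap F x ∘ fun t : ℝ => e + t • w')) 0 := by
    have ht : Tendsto (fun t : ℝ => e + t • w') (𝓝 0) (𝓝[range (𝓡∂ n)] e) := by
      refine tendsto_nhdsWithin_iff.2 ⟨?_, Eventually.of_forall hline⟩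
      simpa using hd.continuousAt.tendsto
    filter_upwards [ht.eventually (eventually_chartMap_mem_range hF.continuous x)] with t ht
    rw [range_cylModel, range_modelWithCornersEuclideanHalfSpace] at ht
    simp only [Function.comp, zero_smul, add_zero, hL, hFe]
    exact ht.1
  have h0 := hmin.hasDerivAt_eq_zero hg'
  have h1 := fderivWithin_chartMap_self hF x w
  exact (congrArg L h1).symm.trans h0

variable [RiemannianBundle (fun x : M => TangentSpace (𝓡∂ n) x)] [IsManifold (𝓡∂ n) ∞ M]
  [RiemannianBundle (fun x : S => TangentSpace (𝓡∂ n) x)]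
  {N : ∀ x : S, TangentSpace (cylModel n) (F x)}

/-- For a hypersurface with free boundary, the height function has vanishing normal derivative
along the boundary. -/
theorem vert_conormal_eq_zero (hF : IsTwoSidedHypersurface F N) (hfb : HasFreeBoundary F N) {x : S}
    (hx : x ∈ (𝓡∂ n).boundary S) {ν : TangentSpace (𝓡∂ n) x} (hν : IsInnerUnitNormal x ν) :
    vert (F x) (mfderiv (𝓡∂ n) (cylModel n) F x ν) = 0 := by
  let D := mfderiv (𝓡∂ n) (cylModel n) F x
  let T : TangentSpace (cylModel n) (F x) →ₗ[ℝ] ℝ :=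
    (EuclideanSpace.proj (0 : Fin n) : EuclideanSpace ℝ (Fin n) →L[ℝ] ℝ).toLinearMap ∘ₗ
      LinearMap.fst ℝ (EuclideanSpace ℝ (Fin n)) ℝ
  have hT : ∀ w, T w = transverse (F x).1 (horiz (F x) w) := fun _ => rfl
  let τ : TangentSpace (𝓡∂ n) x →ₗ[ℝ] ℝ :=
    (EuclideanSpace.proj (0 : Fin n) : EuclideanSpace ℝ (Fin n) →L[ℝ] ℝ).toLinearMap
  have hτ : ∀ w, τ w = transverse x w := fun _ => rfl
  have hTN : T (N x) = 0 := hfb.2 x hx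
  have hker : ∀ w, τ w = 0 → T (D w) = 0 := fun w hw =>
    transverse_mfderiv_eq_zero hF.smooth hx ((hfb.1 x).1 hx) hw
  have hν0 : 0 < τ ν := hν.2.2
  have hTD : ∀ w, T (D w) = τ w / τ ν * T (D ν) := fun w => by
    have h1 : τ (w - (τ w / τ ν) • ν) = 0 := by
      rw [map_sub, map_smul, smul_eq_mul]; field_simp; ring
    have h2 := hker _ h1
    rw [map_sub, map_smul, map_sub, map_smul, smul_eq_mul] at h2
    linarith
  have hne : T (D ν) ≠ 0 := by
    intro h0
    have hall : ∀ w, T w = 0 := fun w => by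
      obtain ⟨v, t, rfl⟩ := exists_tangent_add_normal hF x w
      rw [map_add, map_smul, hTN, hTD, h0]
      simp
    have h1 := hall (show TangentSpace (cylModel n) (F x) from
      ((EuclideanSpace.single (0 : Fin n) (1 : ℝ), 0) : EuclideanSpace ℝ (Fin n) × ℝ))
    have h2 : T (show TangentSpace (cylModel n) (F x) from
      ((EuclideanSpace.single (0 : Fin n) (1 : ℝ), 0) : EuclideanSpace ℝ (Fin n) × ℝ)) =
      (EuclideanSpace.single (0 : Fin n) (1 : ℝ) : EuclideanSpace ℝ (Fin n)) 0 := rfl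
    rw [h2] at h1
    simp at h1
  obtain ⟨k, t, hk⟩ := exists_tangent_add_normal hF x (xi (F x))
  have hTk : T (D k) = 0 := by
    have h1 : T (xi (F x)) = 0 := rfl
    rw [← hk, map_add, map_smul, hTN, smul_zero, add_zero] at h1
    exact h1
  have hτk : τ k = 0 := by
    have := hTD k
    rw [hTk] at this
    rcases mul_eq_zero.1 this.symm with h | h
    · exact (div_eq_zero_iff.1 h).resolve_right hν0.ne'
    · exact absurd h hne
  rw [← cylMetric_xi_right, ← hk, cylMetric_add_smul_right, cylMetric_comm _ _ (N x), hF.normal,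
    hF.isometric, hν.2.1 k hτk]
  ring

end Boundary

section Constant

variable {E : Type*} [NormedAddCommGroup E] [NormedSpace ℝ E]
  {H : Type*} [TopologicalSpace H] {I : ModelWithCorners ℝ E H}
  {S : Type*} [TopologicalSpace S] [ChartedSpace H S]

theorem differential_const (c : ℝ) (x : S) (w : TangentSpace I x) :
    differential I (fun _ : S => c) x w = 0 :=
  congr($(mfderiv_const (I := I) (I' := 𝓘(ℝ, ℝ)) (c := c) (x := x)) w)

theorem grad_const [FiniteDimensional ℝ E] [RiemannianBundle (fun x : S => TangentSpace I x)]
    (c : ℝ) (x : S) :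
    grad I (fun _ : S => c) x = 0 := by
  simp [grad, differential_const]

end Constant

section Rigidity

variable {n : ℕ} [NeZero n]
  {S : Type*} [TopologicalSpace S] [ChartedSpace (EuclideanHalfSpace n) S]
  [RiemannianBundle (fun x : S => TangentSpace (𝓡∂ n) x)]

theorem driftedLaplacian_const (ψ : S → ℝ) (c : ℝ) (x : S) :
    driftedLaplacian (𝓡∂ n) ψ (fun _ => c) x = 0 := by
  have h1 : ∀ v w, hessian (𝓡∂ n) (fun _ : S => c) x v w = 0 := fun v w => by
    have h2 : christoffel (metricTensor (𝓡∂ n)) x v w (grad (𝓡∂ n) (fun _ : S => c) x) = 0 := by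
      have h4 := (dMetric_zero (x := x) 0 v w).1
      have h5 := (dMetric_zero (x := x) v w 0).2.2
      have h6 := (dMetric_zero (x := x) w v 0).2.2
      refine (congrArg (christoffel (metricTensor (𝓡∂ n)) x v w) (grad_const c x)).trans ?_
      have h7 := congr(($h5 + $h6 - $h4) / (2 : ℝ))
      exact h7.trans (by norm_num)
    have h3 : (fun _ : S => c) ∘ (extChartAt (𝓡∂ n) x).symm = fun _ => c := rfl
    rw [hessian, h2, h3, fderivWithin_fun_const]
    have h7 : fderivWithin ℝ (0 : EuclideanSpace ℝ (Fin n) → EuclideanSpace ℝ (Fin n) →L[ℝ] ℝ)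
        (range (𝓡∂ n)) (extChartAt (𝓡∂ n) x x) = 0 := by simp
    rw [sub_zero]
    exact congr($h7 v w)
  rw [driftedLaplacian, grad_const, inner_zero_right]
  simp [metricTrace, h1]

variable {M : Type*} [TopologicalSpace M] [ChartedSpace (EuclideanHalfSpace n) M]
  [IsManifold (𝓡∂ n) ∞ M] [RiemannianBundle (fun x : M => TangentSpace (𝓡∂ n) x)]
  {F : S → M × ℝ} {N : ∀ x : S, TangentSpace (cylModel n) (F x)}

/-- The projection to the base of a hypersurface of constant height is a local isometry. -/
theorem norm_mfderiv_fst_of_height_const (hF : IsTwoSidedHypersurface F N) {c : ℝ}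
    (hc : ∀ x, (F x).2 = c) (x : S) (v : TangentSpace (𝓡∂ n) x) :
    ‖mfderiv (𝓡∂ n) (𝓡∂ n) (fun p => (F p).1) x v‖ = ‖v‖ := by
  have h1 : vert (F x) (mfderiv (𝓡∂ n) (cylModel n) F x v) = 0 := by
    rw [← differential_height hF.smooth, funext hc, differential_const]
  have h2 : mfderiv (𝓡∂ n) (𝓡∂ n) (fun p => (F p).1) x v =
      horiz (F x) (mfderiv (𝓡∂ n) (cylModel n) F x v) := by
    have h3 : MDifferentiableAt (𝓡∂ n) (cylModel n) F x := hF.smooth.mdifferentiableAt (by simp)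
    have h4 := mfderiv_comp x (mdifferentiableAt_fst (I := 𝓡∂ n) (I' := 𝓘(ℝ, ℝ)) (x := F x)) h3
    rw [mfderiv_fst] at h4
    exact congr($h4 v)
  have h5 := hF.isometric x v v
  rw [cylMetric, h1, mul_zero, add_zero, real_inner_self_eq_norm_sq,
    real_inner_self_eq_norm_sq] at h5
  rw [h2]
  exact (sq_eq_sq₀ (norm_nonneg _) (norm_nonneg _)).1 h5

/-- The product of the angle function and the mean curvature is at least `-λ`. -/
theorem neg_le_angle_mul (hF : IsTwoSidedHypersurface F N) {H : S → ℝ} {lam : ℝ} (hlam : 0 ≤ lam)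
    (hH : (∀ x, |H x| ≤ lam) ∨ ((∀ x, angle F N x ≤ 0) ∧ ∀ x, H x ≤ lam)) (x : S) :
    -lam ≤ angle F N x * H x := by
  have h1 := (sq_le_one_iff_abs_le_one _).1 (angle_sq_le_one hF x)
  rcases hH with hH | ⟨hθ, hH⟩
  · have h2 := mul_le_mul h1 (hH x) (abs_nonneg _) zero_le_one
    rw [← abs_mul, one_mul] at h2
    linarith [neg_abs_le (angle F N x * H x)]
  · nlinarith [mul_nonneg (neg_nonneg.2 (hθ x)) (sub_nonneg.2 (hH x)),
      mul_nonneg hlam (neg_le_iff_add_nonneg.1 (abs_le.1 h1).1)]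

end Rigidity
end WeightedCylinder

open WeightedCylinder in
theorem theorem3p2 {n : ℕ} [NeZero n]
    -- the base: a complete connected Riemannian manifold, possibly with boundary
    {M : Type*} [MetricSpace M] [ChartedSpace (EuclideanHalfSpace n) M] [IsManifold (𝓡∂ n) ∞ M]
    [RiemannianBundle (fun x : M => TangentSpace (𝓡∂ n) x)]
    [IsContMDiffRiemannianBundle (𝓡∂ n) ∞ (EuclideanSpace ℝ (Fin n))
      (fun x : M => TangentSpace (𝓡∂ n) x)]
    [IsRiemannianManifold (𝓡∂ n) M] [CompleteSpace M] [ConnectedSpace M]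
    -- the product weight
    (h : M → ℝ) (hh : ContMDiff (𝓡∂ n) 𝓘(ℝ, ℝ) ∞ h) (v : ℝ → ℝ) (hv : ContDiff ℝ ∞ v)
    (lam a : ℝ) (hlam : 0 ≤ lam) (hva : ∀ t ≤ a, lam ≤ deriv v t)
    -- the hypersurface, with its induced Riemannian metric and distance
    {S : Type*} [MetricSpace S] [ChartedSpace (EuclideanHalfSpace n) S] [IsManifold (𝓡∂ n) ∞ S]
    [RiemannianBundle (fun x : S => TangentSpace (𝓡∂ n) x)]
    [IsContMDiffRiemannianBundle (𝓡∂ n) ∞ (EuclideanSpace ℝ (Fin n))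
      (fun x : S => TangentSpace (𝓡∂ n) x)]
    [IsRiemannianManifold (𝓡∂ n) S] [ConnectedSpace S]
    (F : S → M × ℝ) (N : ∀ x : S, TangentSpace (cylModel n) (F x))
    (hF : IsTwoSidedHypersurface F N)
    (hpar : IsParabolic (n := n) (productWeight h v ∘ F))
    (hFa : ∀ x, (F x).2 ≤ a)
    (hH : (∀ x, |weightedMeanCurvature (productWeight h v) F N x| ≤ lam) ∨
      ((∀ x, angle F N x ≤ 0) ∧ ∀ x, weightedMeanCurvature (productWeight h v) F N x ≤ lam)) :
    (((𝓡∂ n).boundary S).Nonempty → IsTangentToSlice (n := n) F a →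
      range F ⊆ range (slice a) ∧
      ∀ p : M, weightedMeanCurvature (productWeight h v) (slice a) (sliceNormal (n := n) a) p
        = lam) ∧
    (CompleteSpace S → HasFreeBoundary F N →
      ∃ s : ℝ, range F = range (slice s) ∧
        ∀ p : M, weightedMeanCurvature (productWeight h v) (slice s) (sliceNormal (n := n) s) p
          = lam) := by
  have hη : ContMDiff (𝓡∂ n) 𝓘(ℝ, ℝ) 2 (fun x => (F x).2) :=
    (contMDiff_snd.comp hF.smooth).of_le (by norm_cast)
  have hbdd : BddAbove (range fun x => (F x).2) := ⟨a, by rintro _ ⟨x, rfl⟩; exact hFa x⟩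
  have hconst : (∀ x ∈ (𝓡∂ n).boundary S, ∀ ν : TangentSpace (𝓡∂ n) x, IsInnerUnitNormal x ν →
      vert (F x) (mfderiv (𝓡∂ n) (cylModel n) F x ν) = 0) → ∃ c, ∀ x, (F x).2 = c := fun hν =>
    hpar _ hη hbdd
      (fun x _ => by
        rw [driftedLaplacian_height hF hh hv]
        linarith [hva _ (hFa x), neg_le_angle_mul hF hlam hH x])
      fun x hx ν hxν => ((differential_height hF.smooth x ν).trans (hν x hx ν hxν)).ge
  have hcurv : ∀ c, (∀ x, (F x).2 = c) → ∀ p : M, weightedMeanCurvature (productWeight h v)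
      (slice c) (sliceNormal (n := n) c) p = lam := fun c hc p => by
    obtain ⟨x⟩ : Nonempty S := inferInstance
    rw [weightedMeanCurvature_slice hh hv]
    have h1 := driftedLaplacian_height hF hh hv x
    rw [funext hc, driftedLaplacian_const, hc x] at h1
    linarith [hva c (hc x ▸ hFa x), neg_le_angle_mul hF hlam hH x]
  refine ⟨fun ⟨x₀, hx₀⟩ htan => ?_, fun _ hfb => ?_⟩
  · obtain ⟨c, hc⟩ := hconst fun x hx ν _ => ((htan x hx).2 _).1 ⟨ν, rfl⟩
    obtain rfl : c = a := (hc x₀).symm.trans (htan x₀ hx₀).1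
    refine ⟨?_, hcurv c hc⟩
    rintro _ ⟨x, rfl⟩
    exact ⟨(F x).1, Prod.ext rfl (hc x).symm⟩
  · obtain ⟨c, hc⟩ := hconst fun x hx ν hν => vert_conormal_eq_zero hF hfb hx hν
    have hsurj : Function.Surjective fun x => (F x).1 :=
      surjective_of_local_isometry (I := 𝓡∂ n)
        ((contMDiff_fst.comp hF.smooth).of_le (by exact_mod_cast le_top))
        (norm_mfderiv_fst_of_height_const hF hc) fun z => (hfb.1 z).symm
    refine ⟨c, Subset.antisymm ?_ ?_, hcurv c hc⟩
    · rintro _ ⟨x, rfl⟩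
      exact ⟨(F x).1, Prod.ext rfl (hc x).symm⟩
    · rintro _ ⟨p, rfl⟩
      obtain ⟨x, hx⟩ := hsurj p
      exact ⟨x, Prod.ext hx (hc x)⟩
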